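/- **Theorem (Impossibility of classical multi-party computation).** There is no classical probabilistic-polynomial-time protocol $\pi$ in the $\mathcal F_{\mathrm{COM}}$-hybrid model such that $\pi$ statistically classical-UC-emulates $\mathcal F_{\mathrm{AND}}$. Here the notions are as follows. *Machines and networks.* A (classical) machine has an identity in $\{0,1\}^*$ and, for every security parameter $k\in\mathbb N$, a randomized function on triples of bitstrings (own state, classical communication register, quantum communication register; between classical machines the latter holds only basis states, i.e. bitstrings). It is probabilistic-polynomial-time if this function is computed by a probabilistic Turing machine in time polynomial in $k$ (given in unary) and the length of the three strings. Two distinct nonempty identities, $\mathtt{environment}$ and $\mathtt{adversary}$, are reserved. A network is a set of machines with distinct identities containing one with identity $\mathtt{environment}$. Its execution on $(k,z)$ starts with all states and the quantum register empty and the message $(\varepsilon,\mathtt{environment},z)$ in the classical register. In each step the recipient of the current message $(\mathit{sender},\mathit{rcpt},m)$ is activated, and applies its function to its state and the two shared registers; if afterwards the classical register is not a message whose sender is the machine just activated, or if the recipient of a message does not exist, the registers are reset to $(\varepsilon,\mathtt{environment},\varepsilon)$ and $\varepsilon$. The network returns $\mathit{out}$ as soon as the environment has sent $(\mathtt{environment},\varepsilon,\mathit{out})$.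 Two networks $N,N'$ are indistinguishable if there is a negligible $\mu$ with $|\Pr[N(k,z)=1]-\Pr[N'(k,z)=1]|\le\mu(k)$ for all $z\in\{0,1\}^*$ and $k\in\mathbb N$. *Protocols and emulation.* A protocol $\pi$ is a set of machines with distinct non-reserved identities, with a designated set $\mathrm{parties}_\pi$ of these identities. For $C\subseteq\mathrm{parties}_\pi$, $\pi^C$ arises by replacing each machine with identity $\mathit{id}\in C$ by a corruption party: on $(\mathtt{adversary},\mathit{id},m)$ it puts $m$ into the classical register, and it forwards any other message $c$ as $(\mathit{id},\mathtt{adversary},c)$. $\pi$ statistically classical-UC-emulates a protocol $\rho$ if for every $C\subseteq\mathrm{parties}_\pi$ and every classical adversary $A$ there is a classical simulator $S$ such that for every classical environment $Z$ the networks $\pi^C\cup\{A,Z\}$ and $\rho^C\cup\{S,Z\}$ are indistinguishable, and such that $S$ is probabilistic-polynomial-time if $A$ is. ($A,S,Z$ are otherwise computationally unbounded.) $\pi$ emulates a functionality $\mathcal F$ if it emulates the protocol consisting of $\mathcal F$ and, for each party in $\mathrm{parties}_\pi$, a dummy-party with the same identity that forwards messages from the environment to $\mathcal F$ and messages from $\mathcal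 F$ to the environment. *Commitments.* $\mathcal F_{\mathrm{COM}}^{P\to Q,\ell}$ behaves as follows: upon the first input $(\mathtt{commit},x)$ with $x\in\{0,1\}^{\ell(k)}$ from $P$, it sends $\mathtt{committed}$ to $Q$; upon input $\mathtt{open}$ from $P$ after that, it sends $(\mathtt{open},x)$ to $Q$. A protocol is in the $\mathcal F_{\mathrm{COM}}$-hybrid model if each of its machines that is not a party is an instance of $\mathcal F_{\mathrm{COM}}^{P\to Q,\ell}$ for some parties $P,Q$ and some $\ell:\mathbb N\to\mathbb N$; there may be any number of instances. It is called probabilistic-polynomial-time here if the machines of all its parties are. *AND.* Alice and Bob are two distinct nonempty identities, both in $\mathrm{parties}_\pi$; the identity of $\mathcal F_{\mathrm{AND}}$ is any identity that is not reserved and not in $\mathrm{parties}_\pi$. $\mathcal F_{\mathrm{AND}}$ expects an input $a\in\{0,1\}$ from Alice and $b\in\{0,1\}$ from Bob (for each of the two, the first single bit sent counts). Once it has both, it sends $a\cdot b$ to Alice and to Bob. Since a machine sends at most one message per activation, it sends the message to Alice in the activation in which the second input arrives, and the message to Bob in the next activation by Alice or Bob. It ignores messages from anyone else. -/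

import Mathlib

namespace ClassicalUC

/-! ### Bitstrings and messages -/

/-- Bitstrings `{0,1}*`. -/
abbrev Bits : Type := List Bool

/-- Identities of machines are bitstrings. -/
abbrev Identity : Type := Bits

/-- The reserved identity of the environment. -/
def environment : Identity := [true]

/-- The reserved identity of the adversary or simulator. -/
def adversary : Identity := [false]

/-- A self-delimiting encoding of a bitstring. -/
def delimit : Bits → Bits
  | [] => [false]
  | b :: x => true :: b :: delimit x

/-- Splits off a leading self-delimited bitstring, if there is one. -/
def undelimit : Bits → Option (Bits × Bits)
  | false :: y => some ([], y)
  | true :: b :: y => (undelimit y).map fun p => (b :: p.1, p.2)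
  | _ => none

/-- The bitstring that encodes a triple `(x, y, z)` of bitstrings. Messages are the triples
`(sender, recipient, m)`. -/
def triple (x y z : Bits) : Bits := delimit x ++ (delimit y ++ z)

/-- Parses a bitstring as a triple. The result is `none` exactly if it does not encode a triple. -/
def parse (c : Bits) : Option (Bits × Bits × Bits) :=
  (undelimit c).bind fun p => (undelimit p.2).map fun q => (p.1, q.1, q.2)

theorem undelimit_delimit (x y : Bits) : undelimit (delimit x ++ y) = some (x, y) := by
  induction x with
  | nil => rfl
  | cons b x ih => simp [delimit, undelimit, ih]

theorem delimit_of_undelimit :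
    ∀ (c x y : Bits), undelimit c = some (x, y) → c = delimit x ++ y
  | [], x, y, h => by simp [undelimit] at h
  | false :: c, x, y, h => by
      simp only [undelimit, Option.some.injEq, Prod.mk.injEq] at h
      obtain ⟨rfl, rfl⟩ := h
      rfl
  | [true], x, y, h => by simp [undelimit] at h
  | true :: b :: c, x, y, h => by
      simp only [undelimit, Option.map_eq_some_iff, Prod.mk.injEq] at h
      obtain ⟨⟨x', y'⟩, h', rfl, rfl⟩ := h
      simp [delimit, delimit_of_undelimit c x' y' h']

theorem parse_triple (x y z : Bits) : parse (triple x y z) = some (x, y, z) := by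
  simp [parse, triple, undelimit_delimit]

theorem triple_of_parse (c x y z : Bits) (h : parse c = some (x, y, z)) : c = triple x y z := by
  simp only [parse, Option.bind_eq_some_iff, Option.map_eq_some_iff, Prod.mk.injEq] at h
  obtain ⟨⟨x', r⟩, h₁, ⟨y', z'⟩, h₂, rfl, rfl, rfl⟩ := h
  rw [delimit_of_undelimit c _ _ h₁, triple, ← delimit_of_undelimit r _ _ h₂]

/-! ### Machines -/

/-- The contents of the registers that a machine acts on: its own state, the classical
communication register, and the quantum communication register. In a network of classical machines
the quantum communication register only ever holds computational basis states, i.e. bitstrings. -/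
structure Regs where
  state : Bits
  cls : Bits
  qnt : Bits

/-- A classical machine (without its identity, which is given by its place in the network): for
every security parameter, a classical state transition operator, i.e. a randomized function on
the contents of the registers. -/
abbrev Machine : Type := ℕ → Regs → PMF Regs

/-- The machine with a deterministic transition function. -/
noncomputable def Machine.det (f : ℕ → Regs → Regs) : Machine := fun k r => PMF.pure (f k r)

/-- The bitstring that encodes the contents of the registers. -/
def Regs.code (r : Regs) : Bits := triple r.state r.cls r.qnt

/-- A machine is probabilistic-polynomial-time if its transition, on security parameter `k` (given
in unary) and register contents `r`, is computed by a polynomial-time Turing machine that is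
supplied with polynomially many independent uniformly random bits. -/
def Machine.IsPPT (M : Machine) : Prop :=
  ∃ (p : Polynomial ℕ) (f : Bits → Bits),
    Nonempty (Turing.TM2ComputableInPolyTime (id : Bits → List Bool) (id : Bits → List Bool) f) ∧
    ∀ (k : ℕ) (r : Regs),
      (M k r).map Regs.code =
        (PMF.uniformOfFintype (Fin (p.eval (k + r.code.length)) → Bool)).map
          fun coins => f (triple (List.replicate k true) r.code (List.ofFn coins))

/-! ### Networks and their execution -/

/-- A network: at most one machine for each identity. -/
abbrev Network : Type := Identity → Option Machine

/-- The global state of a network: the two shared communication registers and the local state of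
every machine. -/
structure Config where
  cls : Bits
  qnt : Bits
  state : Identity → Bits

/-- The communication registers are reset to the empty message to the environment. -/
def Config.reset (state : Identity → Bits) : Config :=
  ⟨triple [] environment [], [], state⟩

/-- After the machine with identity `i` ran: if the classical register does not hold a message with
sender `i`, the environment is activated with the empty message. -/
def Config.afterRun (i : Identity) (state : Identity → Bits) (r : Regs) : Config :=
  match parse r.cls with
  | some (sender, _, _) =>
      if sender = i then ⟨r.cls, r.qnt, Function.update state i r.state⟩
      else Config.reset (Function.update state i r.state)
  | none => Config.reset (Function.update state i r.state)

/-- One step of the execution: the recipient of the current message is activated. (A message to an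
identity that does not occur in the network is discarded, and the environment is activated.) -/
noncomputable def Network.step (N : Network) (k : ℕ) (σ : Config) : PMF Config :=
  match parse σ.cls with
  | some (_, rcpt, _) =>
      match N rcpt with
      | some M => (M k ⟨σ.state rcpt, σ.cls, σ.qnt⟩).map (Config.afterRun rcpt σ.state)
      | none => PMF.pure (Config.reset σ.state)
  | none => PMF.pure (Config.reset σ.state)

/-- The network returns `out` when the environment sends `out` to the empty identity. -/
def Config.output (σ : Config) : Option Bits :=
  match parse σ.cls with
  | some (sender, rcpt, out) => if sender = environment ∧ rcpt = [] then some out else none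
  | none => none

/-- The value returned within the next `n` steps from a given global state; `none` if no value is
returned in that time. -/
noncomputable def Network.run (N : Network) (k : ℕ) : ℕ → Config → PMF (Option Bits)
  | 0, _ => PMF.pure none
  | n + 1, σ => (N.step k σ).bind fun τ =>
      match τ.output with
      | some out => PMF.pure (some out)
      | none => N.run k n τ

/-- The initial global state: the environment is about to be activated with its input `z`. -/
def Config.init (z : Bits) : Config := ⟨triple [] environment z, [], fun _ => []⟩

/-- The probability that the network ever returns the value `out`, on input `z` and security
parameter `k`. -/
noncomputable def Network.exec (N : Network) (k : ℕ) (z out : Bits) : ℝ :=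
  (⨆ n : ℕ, N.run k n (Config.init z) (some out)).toReal

/-- A function of the security parameter is negligible if it vanishes faster than the inverse of
every polynomial. -/
def Negligible (μ : ℕ → ℝ) : Prop :=
  Asymptotics.SuperpolynomialDecay Filter.atTop (fun k : ℕ => (k : ℝ)) μ

/-- Indistinguishability of networks: the probabilities of the return value `1` differ at most
negligibly, uniformly in the input. -/
def Indistinguishable (N N' : Network) : Prop :=
  ∃ μ : ℕ → ℝ, Negligible μ ∧
    ∀ (z : Bits) (k : ℕ), |N.exec k z [true] - N'.exec k z [true]| ≤ μ k

/-! ### Protocols, corruption, and emulation -/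

/-- A classical protocol: a set of classical machines with distinct identities other than the two
reserved ones; some of them are the (corruptible) parties. -/
structure Protocol where
  machine : Identity → Option Machine
  parties : Set Identity
  machine_environment : machine environment = none
  machine_adversary : machine adversary = none
  isSome_of_mem_parties : ∀ i ∈ parties, (machine i).isSome

/-- The corruption party with identity `i`: instructions of the adversary are carried out, other
messages are forwarded to the adversary. The quantum register is not touched. -/
noncomputable def corruptionParty (i : Identity) : Machine :=
  Machine.det fun _ r =>
    match parse r.cls with
    | some (sender, _, m) =>
        if sender = adversary then { r with cls := m }
        else { r with cls := triple i adversary r.cls }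
    | none => r

open Classical in
/-- The network that consists of the protocol, with the parties in `C` replaced by corruption
parties, of an adversary or simulator `A`, and of an environment `Z`. -/
noncomputable def Protocol.network (π : Protocol) (C : Set Identity) (A Z : Machine) : Network :=
  fun i =>
    if i = environment then some Z
    else if i = adversary then some A
    else if i ∈ C ∧ (π.machine i).isSome then some (corruptionParty i)
    else π.machine i

/-- Statistical classical-UC-emulation. All machines are classical and computationally unbounded;
the simulator has to be probabilistic-polynomial-time if the adversary is. -/
def Protocol.Emulates (π ρ : Protocol) : Prop :=
  ∀ C : Set Identity, C ⊆ π.parties → ∀ A : Machine, ∃ S : Machine,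
    (∀ Z : Machine, Indistinguishable (π.network C A Z) (ρ.network C S Z)) ∧
    (A.IsPPT → S.IsPPT)

/-- The dummy-party with identity `i` for the functionality with identity `f`: it forwards messages
between the environment and the functionality, and does not touch the quantum register. -/
noncomputable def dummyParty (f i : Identity) : Machine :=
  Machine.det fun _ r =>
    match parse r.cls with
    | some (sender, _, m) =>
        if sender = environment then { r with cls := triple i f m }
        else if sender = f then { r with cls := triple i environment m }
        else r
    | none => r

open Classical in
/-- The ideal protocol: the functionality `F` with identity `f`, and one dummy-party for each of the
given parties. -/
noncomputable def idealProtocol (parties : Set Identity) (f : Identity) (F : Machine)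
    (hf : f ≠ environment ∧ f ≠ adversary)
    (hp : environment ∉ parties ∧ adversary ∉ parties) : Protocol where
  machine i := if i = f then some F else if i ∈ parties then some (dummyParty f i) else none
  parties := parties
  machine_environment := by rw [if_neg hf.1.symm, if_neg hp.1]
  machine_adversary := by rw [if_neg hf.2.symm, if_neg hp.2]
  isSome_of_mem_parties i hi := by by_cases h : i = f <;> simp [h, hi]

theorem Protocol.reserved_notMem (π : Protocol) :
    environment ∉ π.parties ∧ adversary ∉ π.parties :=
  ⟨fun h => by simpa [π.machine_environment] using π.isSome_of_mem_parties _ h,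
   fun h => by simpa [π.machine_adversary] using π.isSome_of_mem_parties _ h⟩

/-- Statistical classical-UC-emulation of a functionality `F` with identity `f`. -/
def Protocol.EmulatesFunctionality (π : Protocol) (f : Identity) (F : Machine)
    (hf : f ≠ environment ∧ f ≠ adversary) : Prop :=
  π.Emulates (idealProtocol π.parties f F hf π.reserved_notMem)

/-! ### The commitment functionality and the commitment-hybrid model -/

/-- The message `(commit, x)`. -/
def commitMsg (x : Bits) : Bits := true :: x
/-- The message `open`. -/
def openMsg : Bits := [false]
/-- The message `committed`. -/
def committedMsg : Bits := [true]
/-- The message `(open, x)`. -/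
def openedMsg (x : Bits) : Bits := false :: x

/-- The transition function of the commitment functionality with identity `i`. The state is empty
before the first commitment, and `commitMsg x` after a commitment to `x`. Every message other than
a valid `commit` or `open` message of the sender is ignored. -/
def commitmentStep (i sender recipient : Identity) (ℓ : ℕ → ℕ) (k : ℕ) (r : Regs) : Regs :=
  match parse r.cls with
  | some (s, _, m) =>
      if s = sender then
        match r.state, m with
        | [], true :: x =>
            if x.length = ℓ k then ⟨commitMsg x, triple i recipient committedMsg, []⟩
            else ⟨r.state, [], []⟩
        | _ :: x, [false] => ⟨r.state, triple i recipient (openedMsg x), []⟩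
        | _, _ => ⟨r.state, [], []⟩
      else ⟨r.state, [], []⟩
  | none => ⟨r.state, [], []⟩

/-- The commitment functionality `F_COM` for strings of length `ℓ k`, as a machine with
identity `i`. -/
noncomputable def commitment (i sender recipient : Identity) (ℓ : ℕ → ℕ) : Machine :=
  Machine.det (commitmentStep i sender recipient ℓ)

/-- A protocol in the `F_COM`-hybrid model: apart from the parties, the protocol contains only
instances (any number of them) of the commitment functionality between parties. -/
def Protocol.InCommitmentHybridModel (π : Protocol) : Prop :=
  ∀ (i : Identity) (M : Machine), π.machine i = some M → i ∉ π.parties →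
    ∃ sender ∈ π.parties, ∃ recipient ∈ π.parties, ∃ ℓ : ℕ → ℕ,
      M = commitment i sender recipient ℓ

/-- The programs of all parties are probabilistic-polynomial-time. (Nothing is required of the
length functions of the commitment functionalities.) -/
def Protocol.IsPPT (π : Protocol) : Prop :=
  ∀ i ∈ π.parties, ∀ M : Machine, π.machine i = some M → M.IsPPT

/-! ### The AND functionality -/

/-- The data kept by the AND functionality: the inputs received so far, and which outputs have been
sent already. -/
structure AndState where
  inputA : Option Bool
  inputB : Option Bool
  sentA : Bool
  sentB : Bool

/-- The encoding as a bitstring. -/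
def AndState.encode (σ : AndState) : Bits :=
  [σ.inputA.isSome, σ.inputA.getD false, σ.inputB.isSome, σ.inputB.getD false, σ.sentA, σ.sentB]

/-- The decoding of a bitstring; missing bits (as in the initial state) count as `false`. -/
def AndState.decode (s : Bits) : AndState where
  inputA := if s.getD 0 false then some (s.getD 1 false) else none
  inputB := if s.getD 2 false then some (s.getD 3 false) else none
  sentA := s.getD 4 false
  sentB := s.getD 5 false

theorem AndState.decode_encode (σ : AndState) : AndState.decode σ.encode = σ := by
  rcases σ with ⟨_ | _, _ | _, _, _⟩ <;> rfl

theorem AndState.decode_nil : AndState.decode [] = ⟨none, none, false, false⟩ := rfl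

/-- The bit that a message consists of, if it consists of one bit. -/
def bitOf : Bits → Option Bool
  | [x] => some x
  | _ => none

/-- Records an input: only the first bit sent by each of the two parties counts. -/
def AndState.record (alice bob sender : Identity) (m : Bits) (σ : AndState) : AndState :=
  if sender = alice then { σ with inputA := σ.inputA.or (bitOf m) }
  else if sender = bob then { σ with inputB := σ.inputB.or (bitOf m) }
  else σ

/-- Sends the next output message, if both inputs are known and there is one left: the product of
the inputs is sent first to Alice, then to Bob. -/
def AndState.send (f alice bob : Identity) (σ : AndState) : Regs :=
  match σ.inputA, σ.inputB with
  | some a, some b =>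
      if σ.sentA = false then ⟨{ σ with sentA := true }.encode, triple f alice [a && b], []⟩
      else if σ.sentB = false then ⟨{ σ with sentB := true }.encode, triple f bob [a && b], []⟩
      else ⟨σ.encode, [], []⟩
  | _, _ => ⟨σ.encode, [], []⟩

/-- The transition function of the AND functionality with identity `f`. A machine can send only one
message per activation, so the second output message is sent in the next activation by Alice or
Bob. Messages that do not come from Alice or Bob are ignored. -/
def andStep (f alice bob : Identity) (r : Regs) : Regs :=
  match parse r.cls with
  | some (sender, _, m) =>
      if sender = alice ∨ sender = bob then
        ((AndState.decode r.state).record alice bob sender m).send f alice bob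
      else ⟨r.state, [], []⟩
  | none => ⟨r.state, [], []⟩

/-- The AND functionality `F_AND`, as a machine with identity `f`. -/
noncomputable def andFunctionality (f alice bob : Identity) : Machine :=
  Machine.det fun _ r => andStep f alice bob r

end ClassicalUC

/-!
Suppose that `π` emulates the AND functionality, and split its machines into two sides: Alice
together with the commitment functionalities in which she is the committer, and everybody else.
Everything that crosses between the sides is recorded in a *transcript*. The sides only interact
through the transcript and use independent randomness, so the probability of a transcript `t`
on inputs `a`, `b` is a product `α_a(t) * β_b(t)` (`TwoSided.iSup_transcriptProb`,
`HybridProtocol.runProb_mul`). Writing `P_ab(t)` for it, `P_00 * P_11 = P_01 * P_10`: an execution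
of a classical protocol cannot correlate the two inputs in any other way.

A commitment functionality would break this argument if it belonged to neither side. It can be
attributed to its committer, since it holds nothing that its committer does not know; a committer
who follows the protocol can run it in her head. Hence there is an adversary that corrupts the
parties of one side, runs them honestly together with copies of their functionalities
(`HybridProtocol.emulator`), and in the end tells the environment whether the transcript is in a set
`D` of its choice. The environment hands out the inputs `a` and `b` and accepts if Alice and Bob
both report `0` and the adversary answers yes. In the real network it accepts with
probability `∑ t ∈ D, P_ab(t)` (`HybridProtocol.iSup_accept_realNetwork`).

The assumed emulation gives two properties of these probabilities, up to a small error.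

* Correctness. If nobody is corrupted, the ideal network is deterministic, and Alice and Bob
  report `0` exactly if `a && b = false` (`iSup_accept_idealNetwork`). So `P_00`, `P_01` and `P_10`
  have total mass about one, and `P_11` about zero (`HybridProtocol.eventually_mass_univ`).
* Privacy. If one of the two parties is honest, then in the ideal network the simulator can learn
  the honest input only by entering `1` for the other party. If the honest input is `1`, the honest
  party can then only report `1`, and the environment does not accept. So the environment
  accepts with honest input `1` at most as often as with honest input `0`
  (`CoupledNetworks.accept_le`), whence `P_01(D) ≤ P_00(D)` and `P_10(D) ≤ P_00(D)` for every
  `D`, up to the error (`HybridProtocol.eventually_mass_le`).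

Let `D` be the set of the transcripts with `P_01 ≤ P_10`. By privacy, `∑ t, min (P_01 t) (P_10 t)`,
which is `P_01(D) + P_10(Dᶜ)`, is at least about one: the total mass of `P_01` and `P_10` together
is about two, and what is missing here is `P_01(Dᶜ) + P_10(D) ≤ P_00(Dᶜ) + P_00(D) ≈ 1`. But
`min (P_01 t) (P_10 t) ≤ √(P_01 t * P_10 t) = √(P_00 t * P_11 t) ≤ (P_00 t + P_11 t) / 2`, the sum
of which is about one half (`two_mul_le_add_of_mul_eq`, `HybridProtocol.mass_splitSet_le`).
-/

open scoped ENNReal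

namespace ClassicalUC

/-! ### Acceptance probabilities of networks -/

theorem triple_inj {x y z x' y' z' : Bits} :
    triple x y z = triple x' y' z' ↔ x = x' ∧ y = y' ∧ z = z' := by
  constructor
  · intro h
    have := parse_triple x y z
    rw [h, parse_triple] at this
    simpa [eq_comm] using this
  · rintro ⟨rfl, rfl, rfl⟩; rfl

theorem environment_ne_adversary : environment ≠ adversary := by decide

/-- The global state after a machine with identity `i` left `c` and `q` in the communication
registers, `st` being the resulting local states. -/
def Config.dispatch (i : Identity) (st : Identity → Bits) (c q : Bits) : Config :=
  match parse c with
  | some (s, _, _) => if s = i then ⟨c, q, st⟩ else Config.reset st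
  | none => Config.reset st

theorem Config.afterRun_eq (i : Identity) (st : Identity → Bits) (r : Regs) :
    Config.afterRun i st r = Config.dispatch i (Function.update st i r.state) r.cls r.qnt := rfl

theorem Config.dispatch_triple (i : Identity) (st : Identity → Bits) (j m q : Bits) :
    Config.dispatch i st (triple i j m) q = ⟨triple i j m, q, st⟩ := by
  simp [Config.dispatch, parse_triple]

theorem Config.dispatch_nil (i : Identity) (st : Identity → Bits) (q : Bits) :
    Config.dispatch i st [] q = Config.reset st := by
  simp [Config.dispatch, parse, undelimit]

theorem Config.dispatch_cases (i : Identity) (st : Identity → Bits) (c q : Bits) :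
    (∃ j m, c = triple i j m ∧ Config.dispatch i st c q = ⟨c, q, st⟩) ∨
      ((∀ j m, c ≠ triple i j m) ∧ Config.dispatch i st c q = Config.reset st) := by
  unfold Config.dispatch
  rcases h : parse c with _ | ⟨s, j, m⟩
  · right
    refine ⟨?_, rfl⟩
    rintro j m rfl
    simp [parse_triple] at h
  · obtain rfl := triple_of_parse _ _ _ _ h
    by_cases hs : s = i
    · subst hs
      exact Or.inl ⟨j, m, rfl, by simp⟩
    · right
      refine ⟨fun j' m' => ?_, by simp [hs]⟩
      rw [Ne, triple_inj]
      exact fun h => hs h.1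

theorem Config.output_reset (st : Identity → Bits) : (Config.reset st).output = none := by
  simp [Config.output, Config.reset, parse_triple, environment]

theorem Config.output_triple (s j m q : Bits) (st : Identity → Bits) :
    (⟨triple s j m, q, st⟩ : Config).output =
      if s = environment ∧ j = [] then some m else none := by
  simp [Config.output, parse_triple]

theorem Config.output_dispatch {i : Identity} (hi : i ≠ environment) (st : Identity → Bits)
    (c q : Bits) : (Config.dispatch i st c q).output = none := by
  rcases Config.dispatch_cases i st c q with ⟨j, m, rfl, h⟩ | ⟨-, h⟩
  · rw [h, Config.output_triple]
    simp [hi]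
  · rw [h, Config.output_reset]

/-- The probability that the network returns the value `1` within `n` steps. -/
noncomputable def Network.accept (N : Network) (k n : ℕ) (σ : Config) : ℝ≥0∞ :=
  N.run k n σ (some [true])

/-- The same probability, if it is first looked at whether a value is returned right now. -/
noncomputable def Network.acceptNow (N : Network) (k n : ℕ) (σ : Config) : ℝ≥0∞ :=
  match σ.output with
  | some out => if out = [true] then 1 else 0
  | none => N.accept k n σ

variable {N : Network} {k n : ℕ} {σ : Config}

theorem Network.accept_zero : N.accept k 0 σ = 0 := by
  simp [Network.accept, Network.run]

theorem Network.accept_le_one : N.accept k n σ ≤ 1 := PMF.coe_le_one _ _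

theorem Network.accept_succ :
    N.accept k (n + 1) σ = ∑' τ, N.step k σ τ * N.acceptNow k n τ := by
  rw [Network.accept, Network.run, PMF.bind_apply]
  refine tsum_congr fun τ => ?_
  congr 1
  unfold Network.acceptNow
  cases τ.output with
  | none => rfl
  | some out => simp [eq_comm]

theorem Network.acceptNow_of_none (h : σ.output = none) :
    N.acceptNow k n σ = N.accept k n σ := by
  simp [Network.acceptNow, h]

theorem Network.accept_le_succ : N.accept k n σ ≤ N.accept k (n + 1) σ := by
  induction n generalizing σ with
  | zero => simp [Network.accept_zero]
  | succ n ih =>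
    rw [Network.accept_succ, Network.accept_succ]
    refine ENNReal.tsum_le_tsum fun τ => ?_
    gcongr 1
    unfold Network.acceptNow
    cases τ.output with
    | none => exact ih
    | some out => exact le_rfl

theorem Network.accept_mono : Monotone fun n => N.accept k n σ :=
  monotone_nat_of_le_succ fun _ => Network.accept_le_succ

theorem tsum_map_mul {α β : Type} (p : PMF α) (g : α → β) (f : β → ℝ≥0∞) :
    ∑' b, (p.map g) b * f b = ∑' a, p a * f (g a) := by
  classical
  simp only [PMF.map_apply, ← ENNReal.tsum_mul_right]
  rw [ENNReal.tsum_comm]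
  refine tsum_congr fun a => ?_
  rw [tsum_eq_single (g a)]
  · simp
  · intro b hb
    simp [hb]

theorem tsum_pure_mul {β : Type} (b : β) (f : β → ℝ≥0∞) :
    ∑' b', (PMF.pure b) b' * f b' = f b := by
  rw [tsum_eq_single b] <;> simp +contextual

theorem Network.accept_succ_machine {s i m : Bits} {M : Machine} {α : Type} {p : PMF α}
    {g : α → Regs} (hσ : parse σ.cls = some (s, i, m)) (hi : N i = some M)
    (hM : M k ⟨σ.state i, σ.cls, σ.qnt⟩ = p.map g) :
    N.accept k (n + 1) σ =
      ∑' a, p a * N.acceptNow k n (Config.afterRun i σ.state (g a)) := by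
  rw [Network.accept_succ]
  have : N.step k σ = p.map (fun a => Config.afterRun i σ.state (g a)) := by
    simp only [Network.step, hσ, hi, hM, PMF.map_comp]
    rfl
  rw [this, tsum_map_mul]

theorem Network.accept_succ_det {s i m : Bits} {g : ℕ → Regs → Regs}
    (hσ : parse σ.cls = some (s, i, m)) (hi : N i = some (Machine.det g)) :
    N.accept k (n + 1) σ =
      N.acceptNow k n (Config.afterRun i σ.state (g k ⟨σ.state i, σ.cls, σ.qnt⟩)) := by
  rw [Network.accept_succ]
  have : N.step k σ =
      PMF.pure (Config.afterRun i σ.state (g k ⟨σ.state i, σ.cls, σ.qnt⟩)) := by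
    simp only [Network.step, hσ, hi, Machine.det, PMF.pure_map]
  rw [this, tsum_pure_mul]

theorem Network.accept_succ_none {s i m : Bits} (hσ : parse σ.cls = some (s, i, m))
    (hi : N i = none) : N.accept k (n + 1) σ = N.accept k n (Config.reset σ.state) := by
  rw [Network.accept_succ]
  have : N.step k σ = PMF.pure (Config.reset σ.state) := by
    simp only [Network.step, hσ, hi]
  rw [this, tsum_pure_mul, Network.acceptNow_of_none (Config.output_reset _)]

theorem Network.accept_succ_parse_none (hσ : parse σ.cls = none) :
    N.accept k (n + 1) σ = N.accept k n (Config.reset σ.state) := by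
  rw [Network.accept_succ]
  have : N.step k σ = PMF.pure (Config.reset σ.state) := by
    simp only [Network.step, hσ]
  rw [this, tsum_pure_mul, Network.acceptNow_of_none (Config.output_reset _)]

theorem Network.exec_eq (N : Network) (k : ℕ) (z : Bits) :
    N.exec k z [true] = (⨆ n, N.accept k n (Config.init z)).toReal := rfl

/-- The execution from `σ` passes deterministically through `τ`, after `j` steps. -/
def Network.Leads (N : Network) (k j : ℕ) (σ τ : Config) : Prop :=
  ∀ n, N.accept k (n + j) σ = N.accept k n τ

theorem Network.Leads.refl (N : Network) (k : ℕ) (σ : Config) : N.Leads k 0 σ σ := fun _ => rfl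

theorem Network.Leads.trans {i j : ℕ} {τ υ : Config} (h : N.Leads k i σ τ)
    (h' : N.Leads k j τ υ) : N.Leads k (i + j) σ υ := fun n => by
  rw [← h' n, ← h (n + j)]
  congr 1
  omega

theorem Network.Leads.accept_le {j : ℕ} {τ : Config} (h : N.Leads k j σ τ) (n : ℕ) :
    N.accept k n σ ≤ N.accept k n τ := by
  rw [← h n]
  exact Network.accept_mono (by omega)

theorem Network.Leads.iSup_accept {j : ℕ} {τ : Config} (h : N.Leads k j σ τ) :
    ⨆ n, N.accept k n σ = ⨆ n, N.accept k n τ := by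
  refine le_antisymm (iSup_mono fun n => h.accept_le n) (iSup_le fun n => ?_)
  rw [← h n]
  exact le_iSup (fun n => N.accept k n σ) (n + j)

/-- A step of a machine that acts deterministically. -/
theorem Network.Leads.of_pure {s i m : Bits} {M : Machine} {r : Regs} {τ : Config}
    (hσ : parse σ.cls = some (s, i, m)) (hi : N i = some M)
    (hM : M k ⟨σ.state i, σ.cls, σ.qnt⟩ = PMF.pure r)
    (hτ : Config.afterRun i σ.state r = τ) (ho : τ.output = none) : N.Leads k 1 σ τ := fun n => by
  rw [Network.accept_succ_machine (p := PMF.pure ()) (g := fun _ => r) hσ hi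
    (by rw [hM, PMF.pure_map]), tsum_pure_mul, hτ, Network.acceptNow_of_none ho]

/-- A step that returns a value. -/
theorem Network.accept_succ_output {s i m out : Bits} {g : ℕ → Regs → Regs}
    (hσ : parse σ.cls = some (s, i, m)) (hi : N i = some (Machine.det g))
    (ho : (Config.afterRun i σ.state (g k ⟨σ.state i, σ.cls, σ.qnt⟩)).output = some out) :
    N.accept k (n + 1) σ = if out = [true] then 1 else 0 := by
  rw [Network.accept_succ_det hσ hi, Network.acceptNow, ho]

/-! ### Two-sided systems -/

/-- What the activation of a side results in: an internal step that only changes the state of that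
side, a public event, or the failure of the run. -/
inductive Outcome (X E : Type) where
  | internal (x : X)
  | event (e : E) (x : X)
  | dead

/-- A random process with two sides (named by `Bool`) that interact through public events only. The
history of events determines which side is active, or that the run is complete (`turn h = none`).
The active side `v` samples from `dist v h x` and then behaves as `out v h x` says, depending on
nothing but the history and its own state `x`. An event changes the states of both sides by
`upd`. -/
structure TwoSided (X E R : Type) where
  turn : List E → Option Bool
  dist : Bool → List E → X → PMF R
  out : Bool → List E → X → R → Outcome X E
  upd : Bool → List E → E → X → X

namespace TwoSided

variable {X E R : Type}

/-- The value of an outcome, where `W` is the value of the states that may come next. -/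
noncomputable def contrib (T : TwoSided X E R) (W : (Bool → X) → List E → ℝ≥0∞) (S : Bool → X)
    (v : Bool) (h : List E) : Outcome X E → ℝ≥0∞
  | .internal x => W (Function.update S v x) h
  | .event e x => W (fun w => T.upd w h e (Function.update S v x w)) (h ++ [e])
  | .dead => 0

/-- The expectation of `φ` at the final history, over the runs from the states `S` and the history
`h` that are complete after `n` activations. -/
noncomputable def value (T : TwoSided X E R) (φ : List E → ℝ≥0∞) : ℕ → (Bool → X) → List E → ℝ≥0∞
  | 0, _, h => if T.turn h = none then φ h else 0
  | n + 1, S, h =>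
      match T.turn h with
      | none => φ h
      | some v => ∑' r, T.dist v h (S v) r * T.contrib (T.value φ n) S v h (T.out v h (S v) r)

variable {T : TwoSided X E R} {φ : List E → ℝ≥0∞} {S : Bool → X} {h t : List E} {n m : ℕ} {v : Bool}

theorem value_of_turn_none (hT : T.turn h = none) : T.value φ n S h = φ h := by
  cases n <;> simp [value, hT]

theorem value_succ (hT : T.turn h = some v) : T.value φ (n + 1) S h =
    ∑' r, T.dist v h (S v) r * T.contrib (T.value φ n) S v h (T.out v h (S v) r) := by
  simp [value, hT]

theorem contrib_mono {W W' : (Bool → X) → List E → ℝ≥0∞} (hW : ∀ S h, W S h ≤ W' S h)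
    (o : Outcome X E) : T.contrib W S v h o ≤ T.contrib W' S v h o := by
  cases o with
  | internal x => exact hW _ _
  | event e x => exact hW _ _
  | dead => exact le_rfl

theorem value_le_succ : T.value φ n S h ≤ T.value φ (n + 1) S h := by
  induction n generalizing S h with
  | zero =>
    rcases hT : T.turn h with _ | v
    · rw [value_of_turn_none hT, value_of_turn_none hT]
    · simp [value, hT]
  | succ n ih =>
    rcases hT : T.turn h with _ | v
    · rw [value_of_turn_none hT, value_of_turn_none hT]
    · rw [value_succ hT, value_succ hT]
      gcongr
      exact contrib_mono (fun _ _ => ih) _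

theorem value_mono : Monotone fun n => T.value φ n S h :=
  monotone_nat_of_le_succ fun _ => value_le_succ

theorem value_le_one (hφ : ∀ h, φ h ≤ 1) : T.value φ n S h ≤ 1 := by
  induction n generalizing S h with
  | zero =>
    rw [value]
    split_ifs
    exacts [hφ h, zero_le_one]
  | succ n ih =>
    rcases hT : T.turn h with _ | v
    · rw [value_of_turn_none hT]
      exact hφ h
    · rw [value_succ hT, ← (T.dist v h (S v)).tsum_coe]
      refine ENNReal.tsum_le_tsum fun r => mul_le_of_le_one_right' ?_
      cases T.out v h (S v) r with
      | internal x => exact ih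
      | event e x => exact ih
      | dead => exact zero_le_one

open Classical in
/-- The probability that a run from `S` and `h` is complete after `n` activations and has the
transcript `t`. -/
noncomputable def transcriptProb (T : TwoSided X E R) (t : List E) (n : ℕ) (S : Bool → X)
    (h : List E) : ℝ≥0∞ :=
  T.value (fun h => if h = t then 1 else 0) n S h

theorem value_eq_tsum : T.value φ n S h = ∑' t, φ t * T.transcriptProb t n S h := by
  classical
  have base : ∀ h, φ h = ∑' t, φ t * if h = t then 1 else 0 := fun h => by
    rw [tsum_eq_single h]
    · simp
    · intro t ht
      simp [ht.symm]
  unfold transcriptProb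
  induction n generalizing S h with
  | zero =>
    rcases hT : T.turn h with _ | v
    · simp only [value_of_turn_none hT]
      exact base h
    · simp [value, hT]
  | succ n ih =>
    rcases hT : T.turn h with _ | v
    · simp only [value_of_turn_none hT]
      exact base h
    · simp only [value_succ hT, ← ENNReal.tsum_mul_left]
      rw [ENNReal.tsum_comm]
      refine tsum_congr fun r => ?_
      simp only [mul_left_comm (φ _), ENNReal.tsum_mul_left]
      congr 1
      cases T.out v h (S v) r with
      | internal x => exact ih
      | event e x => exact ih
      | dead => simp [contrib]

open Classical in
/-- The weight that side `v` contributes to the runs with transcript `t`: the probability that its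
own activations agree with `t`, if the events of the other side are read off from `t`. -/
noncomputable def sideWeight (T : TwoSided X E R) (v : Bool) (t : List E) :
    ℕ → List E → X → ℝ≥0∞
  | 0, h, _ => if T.turn h = none ∧ h = t then 1 else 0
  | n + 1, h, x =>
      match T.turn h with
      | none => if h = t then 1 else 0
      | some w =>
          if w = v then
            ∑' r, T.dist v h x r *
              match T.out v h x r with
              | .internal x' => T.sideWeight v t n h x'
              | .event e x' =>
                  if h ++ [e] <+: t then T.sideWeight v t n (h ++ [e]) (T.upd v h e x') else 0
              | .dead => 0
          else
            match t[h.length]? with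
            | some e => T.sideWeight v t n (h ++ [e]) (T.upd v h e x)
            | none => 0

theorem sideWeight_of_turn_none {x : X} (hT : T.turn h = none) [Decidable (h = t)] :
    T.sideWeight v t n h x = if h = t then 1 else 0 := by
  cases n <;> simp [sideWeight, hT]

open Classical in
theorem sideWeight_succ_self {x : X} (hT : T.turn h = some v) :
    T.sideWeight v t (n + 1) h x = ∑' r, T.dist v h x r *
      match T.out v h x r with
      | .internal x' => T.sideWeight v t n h x'
      | .event e x' =>
          if h ++ [e] <+: t then T.sideWeight v t n (h ++ [e]) (T.upd v h e x') else 0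
      | .dead => 0 := by
  simp only [sideWeight, hT, if_true]

theorem getElem?_of_append_isPrefix {e : E} (ht : h ++ [e] <+: t) : t[h.length]? = some e := by
  obtain ⟨u, rfl⟩ := ht
  simp

theorem sideWeight_succ_other {x : X} {e : E} (hT : T.turn h = some (!v))
    (ht : h ++ [e] <+: t) :
    T.sideWeight v t (n + 1) h x = T.sideWeight v t n (h ++ [e]) (T.upd v h e x) := by
  simp [sideWeight, hT, getElem?_of_append_isPrefix ht]

theorem sideWeight_le_succ {x : X} :
    T.sideWeight v t n h x ≤ T.sideWeight v t (n + 1) h x := by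
  classical
  induction n generalizing h x with
  | zero =>
    rcases hT : T.turn h with _ | w
    · rw [sideWeight_of_turn_none hT, sideWeight_of_turn_none hT]
    · simp [sideWeight, hT]
  | succ n ih =>
    rcases hT : T.turn h with _ | w
    · rw [sideWeight_of_turn_none hT, sideWeight_of_turn_none hT]
    · rcases eq_or_ne w v with rfl | hw
      · rw [sideWeight_succ_self hT, sideWeight_succ_self hT]
        gcongr with r
        cases T.out w h x r with
        | internal x => exact ih
        | event e x =>
          dsimp only
          split_ifs
          exacts [ih, le_rfl]
        | dead => exact le_rfl
      · rw [sideWeight, sideWeight]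
        simp only [hT, hw, if_false]
        cases t[h.length]? with
        | none => exact le_rfl
        | some e => exact ih

theorem transcriptProb_of_not_isPrefix (ht : ¬ h <+: t) : T.transcriptProb t n S h = 0 := by
  classical
  unfold transcriptProb
  have hne : h ≠ t := by
    rintro rfl
    exact ht List.prefix_rfl
  induction n generalizing S h with
  | zero => simp [value, hne]
  | succ n ih =>
    rcases hT : T.turn h with _ | v
    · simp [value_of_turn_none hT, hne]
    · rw [value_succ hT, ENNReal.tsum_eq_zero]
      intro r
      rw [mul_eq_zero]
      right
      cases T.out v h (S v) r with
      | internal x => exact ih ht hne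
      | event e x =>
        have ht' : ¬ h ++ [e] <+: t := fun h' => ht ((List.prefix_append _ _).trans h')
        refine ih ht' ?_
        rintro rfl
        exact ht' List.prefix_rfl
      | dead => rfl

theorem transcriptProb_le_mul (ht : h <+: t) (v : Bool) :
    T.transcriptProb t n S h ≤
      T.sideWeight v t n h (S v) * T.sideWeight (!v) t n h (S (!v)) := by
  classical
  induction n generalizing S h v with
  | zero =>
    rcases hT : T.turn h with _ | w
    · rw [transcriptProb, value_of_turn_none hT, sideWeight_of_turn_none hT,
        sideWeight_of_turn_none hT]
      split_ifs <;> simp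
    · simp [transcriptProb, value, hT]
  | succ n ih =>
    rcases hT : T.turn h with _ | w
    · rw [transcriptProb, value_of_turn_none hT, sideWeight_of_turn_none hT,
        sideWeight_of_turn_none hT]
      split_ifs <;> simp
    · suffices H : T.transcriptProb t (n + 1) S h ≤
          T.sideWeight w t (n + 1) h (S w) * T.sideWeight (!w) t (n + 1) h (S (!w)) by
        rcases Bool.eq_or_eq_not w v with rfl | rfl
        · exact H
        · rw [mul_comm]
          simpa using H
      rw [transcriptProb, value_succ hT, sideWeight_succ_self hT, ← ENNReal.tsum_mul_right]
      refine ENNReal.tsum_le_tsum fun r => ?_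
      rw [mul_assoc]
      gcongr 1
      cases T.out w h (S w) r with
      | internal x =>
        refine (ih (S := Function.update S w x) ht w).trans ?_
        simp only [Function.update_self]
        rw [Function.update_of_ne (by simp)]
        gcongr 1
        exact sideWeight_le_succ
      | event e x =>
        dsimp only [contrib]
        split_ifs with hp
        · refine (ih (S := fun u => T.upd u h e (Function.update S w x u)) hp w).trans ?_
          simp only [Function.update_self]
          rw [Function.update_of_ne (by simp), sideWeight_succ_other (by simpa using hT) hp]
        · exact (transcriptProb_of_not_isPrefix hp).le.trans zero_le
      | dead => exact zero_le

theorem mul_le_transcriptProb (ht : h <+: t) (v : Bool) :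
    T.sideWeight v t n h (S v) * T.sideWeight (!v) t m h (S (!v)) ≤
      T.transcriptProb t (n + m) S h := by
  classical
  obtain ⟨N, hN⟩ : ∃ N, n + m = N := ⟨_, rfl⟩
  rw [hN]
  induction N generalizing n m S h v with
  | zero =>
    obtain ⟨rfl, rfl⟩ : n = 0 ∧ m = 0 := by omega
    rcases hT : T.turn h with _ | w
    · rw [transcriptProb, value_of_turn_none hT, sideWeight_of_turn_none hT,
        sideWeight_of_turn_none hT]
      split_ifs <;> simp
    · simp [sideWeight, hT]
  | succ N ih =>
    rcases hT : T.turn h with _ | w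
    · rw [transcriptProb, value_of_turn_none hT, sideWeight_of_turn_none hT,
        sideWeight_of_turn_none hT]
      split_ifs <;> simp
    · have H : ∀ n m, n + m = N + 1 →
          T.sideWeight w t n h (S w) * T.sideWeight (!w) t m h (S (!w)) ≤
            T.transcriptProb t (N + 1) S h := by
        intro n m hN
        rcases n with _ | n
        · simp [sideWeight, hT]
        rw [transcriptProb, value_succ hT, sideWeight_succ_self hT, ← ENNReal.tsum_mul_right]
        refine ENNReal.tsum_le_tsum fun r => ?_
        rw [mul_assoc]
        gcongr 1
        cases T.out w h (S w) r with
        | internal x =>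
          refine le_trans ?_ (ih (n := n) (m := m) (S := Function.update S w x) ht w (by omega))
          simp only [Function.update_self]
          rw [Function.update_of_ne (by simp)]
        | event e x =>
          dsimp only [contrib]
          split_ifs with hp
          · rcases m with _ | m
            · simp [sideWeight, hT]
            rw [sideWeight_succ_other (by simpa using hT) hp]
            rcases N with _ | N
            · omega
            refine le_trans ?_ (le_trans (ih (n := n) (m := m + 1)
              (S := fun u => T.upd u h e (Function.update S w x u)) hp w (by omega)) le_rfl)
            simp only [Function.update_self]
            rw [Function.update_of_ne (by simp)]
            gcongr 1
            exact sideWeight_le_succ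
          · simp
        | dead => simp
      rcases Bool.eq_or_eq_not w v with rfl | rfl
      · exact H n m hN
      · rw [mul_comm]
        simpa using H m n (by omega)

/-- The probability of a transcript is the product of a weight that depends on the initial state of
one side only, and a weight that depends on the initial state of the other side only. -/
theorem iSup_transcriptProb (S : Bool → X) (t : List E) :
    ⨆ n, T.transcriptProb t n S [] =
      (⨆ n, T.sideWeight true t n [] (S true)) * ⨆ n, T.sideWeight false t n [] (S false) := by
  refine le_antisymm (iSup_le fun n => ?_) ?_
  · refine (transcriptProb_le_mul (List.nil_prefix) true).trans ?_
    gcongr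
    · exact le_iSup (fun n => T.sideWeight true t n [] (S true)) n
    · exact le_iSup (fun n => T.sideWeight false t n [] (S false)) n
  · rw [ENNReal.iSup_mul]
    refine iSup_le fun n => ?_
    rw [ENNReal.mul_iSup]
    exact iSup_le fun m => (mul_le_transcriptProb (List.nil_prefix) true).trans
      (le_iSup (fun n => T.transcriptProb t n S []) (n + m))

theorem iSup_value (T : TwoSided X E R) (φ : List E → ℝ≥0∞) (S : Bool → X) (h : List E) :
    ⨆ n, T.value φ n S h = ∑' t, φ t * ⨆ n, T.transcriptProb t n S h := by
  refine le_antisymm (iSup_le fun n => ?_) ?_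
  · rw [value_eq_tsum]
    gcongr
    exact le_iSup (fun n => T.transcriptProb _ n S h) n
  · rw [ENNReal.tsum_eq_iSup_sum]
    refine iSup_le fun s => ?_
    simp only [ENNReal.mul_iSup]
    have hmono : ∀ t, Monotone fun n => φ t * T.transcriptProb t n S h :=
      fun t a b hab => by
        dsimp only
        gcongr 1
        exact value_mono hab
    rw [ENNReal.finsetSum_iSup_of_monotone hmono]
    refine iSup_mono fun n => ?_
    rw [value_eq_tsum]
    exact ENNReal.sum_le_tsum s

end TwoSided

/-! ### The environment -/

/-- The empty message to the environment, which is in the register after a reset. -/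
def emptyMsg : Bits := triple [] environment []

/-- What the environment has to find in the classical register for the run to go on: no message
while Bob's input is missing, then the result `0` from Alice, then the result `0` from Bob. -/
def expected (alice bob : Identity) : ℕ → Bits
  | 0 => emptyMsg
  | 1 => triple alice environment [false]
  | _ => triple bob environment [false]

/-- What the environment sends after the first and after the second expected message: Bob's input
`b`, and a message that only makes Bob run again. -/
def nextMsg (bob : Identity) (b : Bool) : ℕ → Bits
  | 0 => triple environment bob [b]
  | _ => triple environment bob []

/-- The environment goes on to phase `y + 1`. It returns `1` after the third expected message. -/
def Regs.proceed (bob : Identity) (b : Bool) (y : ℕ) : Regs :=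
  if y = 2 then ⟨[], triple environment [] [true], []⟩
  else ⟨List.replicate (2 * (y + 1) + 1) true, nextMsg bob b y, []⟩

/-- The environment returns `0`. -/
def Regs.reject : Regs := ⟨[], triple environment [] [false], []⟩

/-- The transition function of the environment with inputs `a`, `b` for Alice and Bob. It waits for
the expected message of phase `y` in the state of length `2 * y + 1`. If `ask` is set, it then
notifies the adversary, and continues from the state of length `2 * y + 2` when it runs again; in
the last phase, it returns `1` only if the adversary answered with the bit `1`. -/
def environmentStep (alice bob : Identity) (a b ask : Bool) (r : Regs) : Regs :=
  if r.state.length = 0 then ⟨[true], triple environment alice [a], []⟩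
  else if r.state.length % 2 = 1 then
    if r.cls = expected alice bob (r.state.length / 2) then
      if ask then
        ⟨List.replicate (r.state.length + 1) true, triple environment adversary [], []⟩
      else Regs.proceed bob b (r.state.length / 2)
    else Regs.reject
  else if r.state.length / 2 - 1 = 2 ∧ r.cls ≠ triple adversary environment [true] then Regs.reject
  else Regs.proceed bob b (r.state.length / 2 - 1)

/-- The environment that tests the protocol on the inputs `a` and `b`. -/
noncomputable def testEnvironment (alice bob : Identity) (a b ask : Bool) : Machine :=
  Machine.det fun _ => environmentStep alice bob a b ask

/-! ### The honest protocol as a two-sided system -/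

/-- A description of the machines of a protocol in the commitment-hybrid model: sender, recipient
and length of every commitment functionality. -/
structure HybridProtocol (π : Protocol) where
  comm : Identity → Option (Identity × Identity × (ℕ → ℕ))
  comm_of_mem_parties : ∀ i ∈ π.parties, comm i = none
  machine_eq : ∀ i ∉ π.parties, π.machine i = (comm i).map fun c => commitment i c.1 c.2.1 c.2.2
  recipient_mem : ∀ i c, comm i = some c → c.2.1 ∈ π.parties

theorem Protocol.InCommitmentHybridModel.nonempty_hybridProtocol {π : Protocol}
    (h : π.InCommitmentHybridModel) : Nonempty (HybridProtocol π) := by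
  have : ∀ i, ∃ o : Option (Identity × Identity × (ℕ → ℕ)),
      (i ∈ π.parties → o = none) ∧
      (i ∉ π.parties → π.machine i = o.map fun c => commitment i c.1 c.2.1 c.2.2) ∧
      ∀ c, o = some c → c.2.1 ∈ π.parties := by
    intro i
    by_cases hi : i ∈ π.parties
    · exact ⟨none, fun _ => rfl, fun h => absurd hi h, by simp⟩
    rcases hM : π.machine i with _ | M
    · exact ⟨none, fun _ => rfl, fun _ => rfl, by simp⟩
    obtain ⟨s, -, r, hr, ℓ, rfl⟩ := h i M hM hi
    exact ⟨some (s, r, ℓ), fun h => absurd h hi, fun _ => rfl, by simpa using hr⟩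
  choose comm h₁ h₂ h₃ using this
  exact ⟨⟨comm, h₁, h₂, h₃⟩⟩

/-- The local states of the machines of one side, as a list of updates, the last one first. -/
abbrev Log : Type := List (Identity × Bits)

/-- The local state of the machine with identity `i`. -/
def Log.get (l : Log) (i : Identity) : Bits := (l.lookup i).getD []

theorem Log.get_cons (l : Log) (i j : Identity) (s : Bits) :
    Log.get ((j, s) :: l) i = if i = j then s else Log.get l i := by
  unfold Log.get
  rw [List.lookup_cons]
  by_cases h : i = j
  · simp [h]
  · simp [h, beq_eq_false_iff_ne.mpr h]

/-- A public event: the contents of the registers when they are passed from one side to the other,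
or `none` if the environment gets the message that it expects. -/
abbrev Event : Type := Option (Bits × Bits)

/-- The state of a side: its input, the local states of its machines, and the contents of the
registers if it is active. -/
structure Side where
  input : Bool
  log : Log
  cls : Bits
  qnt : Bits

/-- Where the control goes: to a party, which finds `c` and `q` in the registers, or to the
environment, which finds `c` in the classical register. -/
inductive Dest where
  | party (c q : Bits) (i : Identity)
  | env (c : Bits)

/-- The number of times that the environment got the message that it expects. -/
def yields (h : List Event) : ℕ := h.count none

/-- The side that is active next. Alice is the side `true`, everybody else the side `false`. After
every visit to the environment, Bob is activated. -/
def activeSide (h : List Event) : Bool :=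
  h.foldl (fun v e => if e.isSome then !v else false) true

theorem activeSide_concat (h : List Event) (e : Event) :
    activeSide (h ++ [e]) = if e.isSome then !activeSide h else false := by
  simp [activeSide]

theorem yields_concat (h : List Event) (e : Event) :
    yields (h ++ [e]) = yields h + if e = none then 1 else 0 := by
  rcases e with _ | e <;> simp [yields, List.count_append]

namespace HybridProtocol

variable {π : Protocol} (d : HybridProtocol π) (alice bob : Identity) (k : ℕ)

/-- The program of a party; a junk machine if `i` is no machine of the protocol. -/
noncomputable def program (_ : HybridProtocol π) (i : Identity) : Machine :=
  (π.machine i).getD (Machine.det fun _ r => r)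

theorem machine_of_mem {i : Identity} (hi : i ∈ π.parties) :
    π.machine i = some (d.program i) := by
  have := π.isSome_of_mem_parties i hi
  rw [Option.isSome_iff_exists] at this
  obtain ⟨M, hM⟩ := this
  simp [program, hM]

open Classical in
/-- What follows when party `i` halted with the register contents `r`: a message to a commitment
functionality is processed at once. A commitment functionality that is not instructed by its sender
gives the control back to the environment. -/
noncomputable def route (i : Identity) (l : Log) (r : Regs) : Log × Dest :=
  let l' := (i, r.state) :: l
  match parse r.cls with
  | some (s, j, _) =>
      if s ≠ i then (l', .env emptyMsg)
      else if j = environment then (l', .env r.cls)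
      else if j ∈ π.parties then (l', .party r.cls r.qnt j)
      else
        match d.comm j with
        | some (sender, recipient, ℓ) =>
            if sender = i then
              let r' := commitmentStep j sender recipient ℓ k ⟨Log.get l' j, r.cls, r.qnt⟩
              ((j, r'.state) :: l',
                if r'.cls = [] then .env emptyMsg else .party r'.cls [] recipient)
            else (l', .env emptyMsg)
        | none => (l', .env emptyMsg)
  | none => (l', .env emptyMsg)

/-- The activation of the party that is the recipient in the classical register. -/
noncomputable def sideDist (x : Side) : PMF Regs :=
  match parse x.cls with
  | some (_, i, _) => d.program i k ⟨Log.get x.log i, x.cls, x.qnt⟩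
  | none => PMF.pure ⟨[], [], []⟩

/-- The side of a party. -/
def ownSide (i : Identity) : Bool := decide (i = alice)

/-- Turns the destination of the control into an outcome for side `v`. -/
def destOutcome (v : Bool) (h : List Event) (b : Bool) (p : Log × Dest) : Outcome Side Event :=
  match p.2 with
  | .party c q j =>
      if ownSide alice j = v then .internal ⟨b, p.1, c, q⟩
      else .event (some (c, q)) ⟨b, p.1, [], []⟩
  | .env c => if c = expected alice bob (yields h) then .event none ⟨b, p.1, [], []⟩ else .dead

/-- The interaction of Alice's side with everybody else's side, in a run where the environment
always gets what it expects. A commitment functionality belongs to the side of its sender. -/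
noncomputable def system : TwoSided Side Event Regs where
  turn h := if 3 ≤ yields h then none else some (activeSide h)
  dist _ _ x := d.sideDist k x
  out v h x r :=
    match parse x.cls with
    | some (_, i, _) => destOutcome alice bob v h x.input (d.route k i x.log r)
    | none => .dead
  upd v h e x :=
    match e with
    | some (c, q) => { x with cls := c, qnt := q }
    | none => if v then x else { x with cls := nextMsg bob x.input (yields h), qnt := [] }

/-- The initial states of the two sides, with inputs `a` and `b`. -/
def initial (a b : Bool) : Bool → Side
  | true => ⟨a, [], triple environment alice [a], []⟩
  | false => ⟨b, [], [], []⟩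

/-- The probability that the honest protocol, run on the inputs `a` and `b`, has the transcript `t`
and yields the results that are expected for the product `0`. -/
noncomputable def runProb (a b : Bool) (t : List Event) : ℝ≥0∞ :=
  ⨆ n, (d.system alice bob k).transcriptProb t n (initial alice a b) []

/-- The cut-and-paste property: the probability is the product of a weight that depends on Alice's
input only and a weight that depends on Bob's input only. -/
theorem runProb_mul (t : List Event) :
    d.runProb alice bob k false false t * d.runProb alice bob k true true t =
      d.runProb alice bob k false true t * d.runProb alice bob k true false t := by
  simp only [runProb, TwoSided.iSup_transcriptProb, initial]
  ring

end HybridProtocol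

/-! ### The adversary that runs the corrupted side honestly -/

/-- The memory of the emulating adversary: the local states of the machines of the corrupted side,
and the events so far. -/
abbrev Memory : Type := Log × List Event

/-- A unary encoding; the adversary is computationally unbounded. -/
def encodeMemory (μ : Memory) : Bits := List.replicate (Encodable.encode μ) true

/-- Inverse of `encodeMemory`. -/
def decodeMemory (s : Bits) : Memory := (Encodable.decode s.length).getD ([], [])

theorem decodeMemory_encodeMemory (μ : Memory) : decodeMemory (encodeMemory μ) = μ := by
  simp [decodeMemory, encodeMemory]

theorem encodeMemory_nil : encodeMemory ([], []) = [] := by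
  simp [encodeMemory, Nat.pair]

theorem commitmentStep_of_ne {i sender recipient : Identity} {ℓ : ℕ → ℕ} {k : ℕ} {s j m : Bits}
    {st q : Bits} (hs : s ≠ sender) :
    commitmentStep i sender recipient ℓ k ⟨st, triple s j m, q⟩ = ⟨st, [], []⟩ := by
  simp [commitmentStep, parse_triple, hs]

theorem commitmentStep_message (i sender recipient : Identity) (ℓ : ℕ → ℕ) (k : ℕ) (r : Regs) :
    (commitmentStep i sender recipient ℓ k r).qnt = [] ∧
      ((commitmentStep i sender recipient ℓ k r).cls = [] ∨
        ∃ m, (commitmentStep i sender recipient ℓ k r).cls = triple i recipient m) := by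
  unfold commitmentStep
  split
  · split_ifs
    · split
      · split_ifs <;> simp [triple_inj]
      · simp [triple_inj]
      · simp
    · simp
  · simp

theorem triple_ne_nil (x y z : Bits) : triple x y z ≠ [] := by
  intro h
  have := parse_triple x y z
  simp [h, parse, undelimit] at this

namespace HybridProtocol

variable {π : Protocol} (d : HybridProtocol π) (alice bob : Identity) (k : ℕ)

open Classical in
/-- The side of the sender of the message in the classical register, if it is a machine of the
protocol. -/
noncomputable def senderSide (c : Bits) : Option Bool :=
  match parse c with
  | some (s, _, _) =>
      if s ∈ π.parties then some (ownSide alice s)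
      else (d.comm s).map fun p => ownSide alice p.1
  | none => none

/-- Side `w` records an incoming event, if the message is from the other side. -/
noncomputable def receive (w : Bool) (h : List Event) (c q : Bits) : List Event :=
  if d.senderSide alice c = some (!w) then h ++ [some (c, q)] else h

/-- Side `w` records an outgoing event, if the control goes to the other side. -/
def sent (w : Bool) (h : List Event) : Dest → List Event
  | .party c q j => if ownSide alice j = w then h else h ++ [some (c, q)]
  | .env _ => h

open Classical in
/-- The instructions of the emulating adversary, after its emulation of the corrupted party `i`
halted with `r`. (A message to the adversary itself only resets the registers.) -/
noncomputable def reply (w : Bool) (i : Identity) (l : Log) (h : List Event) (r : Regs) : Regs :=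
  ⟨encodeMemory ((d.route k i l r).1, sent alice w h (d.route k i l r).2),
    if ∃ m, r.cls = triple i adversary m then [] else triple adversary i r.cls, r.qnt⟩

open Classical in
/-- The adversary that corrupts the parties of side `κ` (nobody if `κ = none`) and lets them behave
honestly. When it is activated by the environment, it records that the environment got the expected
message, and answers with the value of `D` at the events so far. -/
noncomputable def emulator (κ : Option Bool) (D : ℕ → List Event → Bool) : Machine := fun k r =>
  match parse r.cls with
  | some (s, _, m) =>
      if s = environment then
        PMF.pure ⟨encodeMemory ((decodeMemory r.state).1, (decodeMemory r.state).2 ++ [none]),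
          triple adversary environment [D k ((decodeMemory r.state).2 ++ [none])], []⟩
      else if s ∈ π.parties ∧ κ = some (ownSide alice s) then
        (d.program s k ⟨Log.get (decodeMemory r.state).1 s, m, r.qnt⟩).map
          (d.reply alice k (ownSide alice s) s (decodeMemory r.state).1
            (d.receive alice (ownSide alice s) (decodeMemory r.state).2 m r.qnt))
      else PMF.pure ⟨r.state, [], []⟩
  | none => PMF.pure ⟨r.state, [], []⟩

/-- The parties of side `κ`. -/
def corrupted (π : Protocol) (κ : Option Bool) : Set Identity :=
  {i | i ∈ π.parties ∧ κ = some (ownSide alice i)}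

variable (a b : Bool) (κ : Option Bool) (D : ℕ → List Event → Bool)

/-- The test environment with the protocol and the emulating adversary. It notifies the adversary
if there is a corrupted side. -/
noncomputable def realNetwork : Network :=
  π.network (corrupted alice π κ) (d.emulator alice κ D)
    (testEnvironment alice bob a b κ.isSome)

/-- The indicator function of the transcripts that the adversary accepts. -/
noncomputable def verdict (t : List Event) : ℝ≥0∞ := if D k t then 1 else 0

/-- The local states agree with the logs of the two sides, in phase `y`. -/
structure StatesMatch (L : Bool → Log) (y : ℕ) (st : Identity → Bits) : Prop where
  env : st environment = List.replicate (2 * y + 1) true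
  party : ∀ i ∈ π.parties, κ ≠ some (ownSide alice i) →
    st i = Log.get (L (ownSide alice i)) i
  comm : ∀ i c, d.comm i = some c → st i = Log.get (L (ownSide alice c.1)) i

/-- The global state `σ` of the real network corresponds to the states `S` of the two sides and the
history `h`, and the recipient in the classical register is a party of the active side. The
adversary has recorded all events, except for a message to the corrupted side that is in the
register right now. -/
structure Matches (S : Bool → Side) (h : List Event) (σ : Config) : Prop where
  yields_lt : yields h < 3
  cls_eq : σ.cls = (S (activeSide h)).cls
  qnt_eq : σ.qnt = (S (activeSide h)).qnt
  input_eq : (S false).input = b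
  addressed : ∃ s i m, σ.cls = triple s i m ∧ s ≠ adversary ∧ i ∈ π.parties ∧
    ownSide alice i = activeSide h
  states : d.StatesMatch alice κ (fun w => (S w).log) (yields h) σ.state
  memory : ∀ w, κ = some w → ∃ h', σ.state adversary = encodeMemory ((S w).log, h') ∧
    if activeSide h = w then d.receive alice w h' σ.cls σ.qnt = h else h' = h

/-- From `σ`, at most `B` deterministic steps lead to a global state that corresponds to `S` and
`h`, or to the return of the verdict if the run is complete. -/
def Reaches (B : ℕ) (S : Bool → Side) (h : List Event) (σ : Config) : Prop :=
  (∃ τ, d.Matches alice b κ S h τ ∧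
    ∃ j ≤ B, (d.realNetwork alice bob a b κ D).Leads k j σ τ) ∨
  (3 ≤ yields h ∧ (∀ n, (d.realNetwork alice bob a b κ D).accept k n σ ≤ verdict k D h) ∧
    verdict k D h ≤ (d.realNetwork alice bob a b κ D).accept k B σ)

/-- From `σ`, at most `B` deterministic steps lead to a global state that corresponds to the outcome
`o` of the activation of side `v`. -/
def Realizes (B : ℕ) (S : Bool → Side) (v : Bool) (h : List Event) (σ : Config) :
    Outcome Side Event → Prop
  | .internal x => d.Reaches alice bob k a b κ D B (Function.update S v x) h σ
  | .event e x => d.Reaches alice bob k a b κ D B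
      (fun w => (d.system alice bob k).upd w h e (Function.update S v x w)) (h ++ [e]) σ
  | .dead => ∀ n, (d.realNetwork alice bob a b κ D).accept k n σ = 0

variable {d alice bob k a b κ D} {B : ℕ} {S : Bool → Side} {v : Bool} {h : List Event}
  {σ τ : Config} {o : Outcome Side Event}

theorem Reaches.of_leads {j : ℕ} (hτ : d.Reaches alice bob k a b κ D B S h τ)
    (hl : (d.realNetwork alice bob a b κ D).Leads k j σ τ) :
    d.Reaches alice bob k a b κ D (B + j) S h σ := by
  rcases hτ with ⟨υ, hυ, i, hi, hl'⟩ | ⟨hy, h₁, h₂⟩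
  · exact Or.inl ⟨υ, hυ, j + i, by omega, hl.trans hl'⟩
  · exact Or.inr ⟨hy, fun n => (hl.accept_le n).trans (h₁ n), by rwa [hl B]⟩

theorem Realizes.of_leads {j : ℕ} (hτ : d.Realizes alice bob k a b κ D B S v h τ o)
    (hl : (d.realNetwork alice bob a b κ D).Leads k j σ τ) :
    d.Realizes alice bob k a b κ D (B + j) S v h σ o := by
  cases o with
  | internal x => exact Reaches.of_leads hτ hl
  | event e x => exact Reaches.of_leads hτ hl
  | dead => exact fun n => le_antisymm ((hl.accept_le n).trans (hτ n).le) zero_le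

theorem Reaches.mono {B' : ℕ} (hτ : d.Reaches alice bob k a b κ D B S h τ) (hB : B ≤ B') :
    d.Reaches alice bob k a b κ D B' S h τ := by
  rcases hτ with ⟨υ, hυ, i, hi, hl⟩ | ⟨hy, h₁, h₂⟩
  · exact Or.inl ⟨υ, hυ, i, hi.trans hB, hl⟩
  · exact Or.inr ⟨hy, h₁, h₂.trans (Network.accept_mono hB)⟩

theorem Realizes.mono {B' : ℕ} (hτ : d.Realizes alice bob k a b κ D B S v h τ o) (hB : B ≤ B') :
    d.Realizes alice bob k a b κ D B' S v h τ o := by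
  cases o with
  | internal x => exact Reaches.mono hτ hB
  | event e x => exact Reaches.mono hτ hB
  | dead => exact hτ

theorem _root_.ClassicalUC.Protocol.ne_of_mem {i : Identity} (hi : i ∈ π.parties) :
    i ≠ environment ∧ i ≠ adversary :=
  ⟨fun h => π.reserved_notMem.1 (h ▸ hi), fun h => π.reserved_notMem.2 (h ▸ hi)⟩

theorem comm_eq_some {i : Identity} {c} (h : d.comm i = some c) :
    i ∉ π.parties ∧ i ≠ environment ∧ i ≠ adversary := by
  have hi : i ∉ π.parties := fun hi => by simp [d.comm_of_mem_parties i hi] at h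
  have hM := d.machine_eq i hi
  rw [h] at hM
  refine ⟨hi, ?_, ?_⟩
  · rintro rfl
    simp [π.machine_environment] at hM
  · rintro rfl
    simp [π.machine_adversary] at hM

theorem comm_environment : d.comm environment = none := by
  rcases h : d.comm environment with _ | c
  · rfl
  · exact absurd rfl (comm_eq_some h).2.1

theorem realNetwork_environment : d.realNetwork alice bob a b κ D environment =
    some (testEnvironment alice bob a b κ.isSome) := by
  simp [realNetwork, Protocol.network]

theorem realNetwork_adversary :
    d.realNetwork alice bob a b κ D adversary = some (d.emulator alice κ D) := by
  simp [realNetwork, Protocol.network, environment_ne_adversary.symm]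

theorem realNetwork_corrupted {i : Identity} (hi : i ∈ π.parties)
    (hκ : κ = some (ownSide alice i)) :
    d.realNetwork alice bob a b κ D i = some (corruptionParty i) := by
  have := Protocol.ne_of_mem hi
  simp [realNetwork, Protocol.network, this, corrupted, hi, hκ, π.isSome_of_mem_parties i hi]

theorem realNetwork_honest {i : Identity} (hi : i ∈ π.parties)
    (hκ : κ ≠ some (ownSide alice i)) :
    d.realNetwork alice bob a b κ D i = some (d.program i) := by
  have := Protocol.ne_of_mem hi
  simp [realNetwork, Protocol.network, this, corrupted, hκ, d.machine_of_mem hi]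

theorem realNetwork_of_notMem {i : Identity} (hi : i ∉ π.parties) (h₁ : i ≠ environment)
    (h₂ : i ≠ adversary) : d.realNetwork alice bob a b κ D i =
      (d.comm i).map fun c => commitment i c.1 c.2.1 c.2.2 := by
  simp [realNetwork, Protocol.network, h₁, h₂, corrupted, hi, d.machine_eq i hi]

end HybridProtocol

/-! ### The real network behaves like the two-sided system -/

section

variable {alice bob : Identity} {a b ask : Bool} {y : ℕ} {c q : Bits}

theorem environmentStep_waiting :
    environmentStep alice bob a b ask ⟨List.replicate (2 * y + 1) true, c, q⟩ =
      if c = expected alice bob y then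
        if ask then
          ⟨List.replicate (2 * y + 2) true, triple environment adversary [], []⟩
        else Regs.proceed bob b y
      else Regs.reject := by
  have h : (2 * y + 1) / 2 = y := by omega
  simp [environmentStep, h]

theorem environmentStep_asked :
    environmentStep alice bob a b ask ⟨List.replicate (2 * y + 2) true, c, q⟩ =
      if y = 2 ∧ c ≠ triple adversary environment [true] then Regs.reject
      else Regs.proceed bob b y := by
  simp [environmentStep]

theorem nextMsg_eq : ∃ m, nextMsg bob b y = triple environment bob m := by
  rcases y with _ | y
  exacts [⟨_, rfl⟩, ⟨_, rfl⟩]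

theorem output_afterRun_reject (st : Identity → Bits) :
    (Config.afterRun environment st Regs.reject).output = some [false] := by
  rw [Config.afterRun_eq, Regs.reject, Config.dispatch_triple, Config.output_triple]
  simp

theorem output_afterRun_accept (st : Identity → Bits) :
    (Config.afterRun environment st (Regs.proceed bob b 2)).output = some [true] := by
  rw [Config.afterRun_eq, Regs.proceed, if_pos rfl, Config.dispatch_triple, Config.output_triple]
  simp

theorem afterRun_proceed (hy : y ≠ 2) (st : Identity → Bits) :
    Config.afterRun environment st (Regs.proceed bob b y) = ⟨nextMsg bob b y, [],
      Function.update st environment (List.replicate (2 * (y + 1) + 1) true)⟩ := by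
  obtain ⟨m, hm⟩ := nextMsg_eq (bob := bob) (b := b) (y := y)
  rw [Config.afterRun_eq, Regs.proceed, if_neg hy, hm, Config.dispatch_triple]

theorem output_nextMsg (hb : bob ≠ []) (st : Identity → Bits) :
    (⟨nextMsg bob b y, q, st⟩ : Config).output = none := by
  obtain ⟨m, hm⟩ := nextMsg_eq (bob := bob) (b := b) (y := y)
  rw [hm, Config.output_triple]
  simp [hb]

end

namespace HybridProtocol

variable {π : Protocol} {d : HybridProtocol π} {alice bob : Identity} {k : ℕ} {a b : Bool}
  {κ : Option Bool} {D : ℕ → List Event → Bool} {S : Bool → Side} {v : Bool} {h : List Event}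
  {σ : Config}

theorem StatesMatch.update {L : Bool → Log} {y : ℕ} {st : Identity → Bits} {i : Identity}
    (hst : d.StatesMatch alice κ L y st) (h₁ : i ≠ environment)
    (h₂ : i ∉ π.parties ∨ κ = some (ownSide alice i)) (h₃ : d.comm i = none) (s : Bits) :
    d.StatesMatch alice κ L y (Function.update st i s) where
  env := by rw [Function.update_of_ne h₁.symm, hst.env]
  party j hj hκ := by
    rw [Function.update_of_ne, hst.party j hj hκ]
    rintro rfl
    exact h₂.elim (fun h => h hj) hκ
  comm j c hc := by
    rw [Function.update_of_ne, hst.comm j c hc]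
    rintro rfl
    simp [h₃] at hc

theorem StatesMatch.update_environment {L : Bool → Log} {y : ℕ} {st : Identity → Bits}
    (hst : d.StatesMatch alice κ L y st) (y' : ℕ) :
    d.StatesMatch alice κ L y'
      (Function.update st environment (List.replicate (2 * y' + 1) true)) where
  env := by simp
  party j hj hκ := by
    rw [Function.update_of_ne (Protocol.ne_of_mem hj).1, hst.party j hj hκ]
  comm j c hc := by
    rw [Function.update_of_ne (comm_eq_some hc).2.1, hst.comm j c hc]

theorem StatesMatch.update_environment' {L : Bool → Log} {y : ℕ} {st : Identity → Bits}
    (hst : d.StatesMatch alice κ L y st) (y' : ℕ) (s : Bits) :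
    d.StatesMatch alice κ L y' (Function.update (Function.update st adversary s) environment
      (List.replicate (2 * y' + 1) true)) :=
  (StatesMatch.update hst environment_ne_adversary.symm (Or.inl π.reserved_notMem.2) (by
    rcases hc : d.comm adversary with _ | c
    · rfl
    · exact absurd rfl (comm_eq_some hc).2.2) s).update_environment y'

theorem senderSide_nextMsg {y : ℕ} : d.senderSide alice (nextMsg bob b y) = none := by
  obtain ⟨m, hm⟩ := nextMsg_eq (bob := bob) (b := b) (y := y)
  simp [hm, senderSide, parse_triple, π.reserved_notMem.1, comm_environment]

theorem upd_log (e : Event) (x : Side) :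
    ((d.system alice bob k).upd v h e x).log = x.log := by
  rcases e with _ | ⟨c, q⟩
  · cases v <;> rfl
  · rfl

theorem upd_input (e : Event) (x : Side) :
    ((d.system alice bob k).upd v h e x).input = x.input := by
  rcases e with _ | ⟨c, q⟩
  · cases v <;> rfl
  · rfl

theorem update_log (S : Bool → Side) (v w : Bool) (x : Side) :
    (Function.update S v x w).log = Function.update (fun w => (S w).log) v x.log w := by
  rcases eq_or_ne w v with rfl | hw
  · simp
  · simp [hw]

theorem update_input (S : Bool → Side) (v w : Bool) (x : Side) (hx : x.input = (S v).input) :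
    (Function.update S v x w).input = (S w).input := by
  rcases eq_or_ne w v with rfl | hw
  · simp [hx]
  · simp [hw]

/-- After the expected message of phase `y` was received and recorded, Bob is activated next. -/
theorem matches_nextMsg (hbob : bob ∈ π.parties) (hab : alice ≠ bob)
    (hin : (S false).input = b) {x : Side} (hx : x.input = (S v).input)
    (hy : yields h < 2) {st : Identity → Bits}
    (hst : d.StatesMatch alice κ (Function.update (fun w => (S w).log) v x.log) (yields h + 1) st)
    (hmem : ∀ w, κ = some w → st adversary =
      encodeMemory (Function.update (fun w => (S w).log) v x.log w, h ++ [none])) :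
    d.Matches alice b κ
      (fun w => (d.system alice bob k).upd w h none (Function.update S v x w)) (h ++ [none])
      ⟨nextMsg bob b (yields h), [], st⟩ where
  yields_lt := by rw [yields_concat, if_pos rfl]; omega
  cls_eq := by
    rw [activeSide_concat]
    simp only [Option.isSome_none, Bool.false_eq_true, if_false, system]
    rw [update_input S v false x hx, hin]
  qnt_eq := by
    rw [activeSide_concat]
    simp [system]
  input_eq := by
    rw [upd_input, update_input S v false x hx, hin]
  addressed := by
    obtain ⟨m, hm⟩ := nextMsg_eq (bob := bob) (b := b) (y := yields h)
    refine ⟨environment, bob, m, hm, environment_ne_adversary, hbob, ?_⟩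
    rw [activeSide_concat]
    simp [ownSide, hab.symm]
  states := by
    rw [yields_concat, if_pos rfl]
    simpa only [upd_log, update_log] using hst
  memory w hw := by
    refine ⟨h ++ [none], ?_, ?_⟩
    · rw [upd_log, update_log]
      exact hmem w hw
    · simp [receive, senderSide_nextMsg]

/-- The environment is activated. -/
theorem realizes_env (hbob : bob ∈ π.parties) (hab : alice ≠ bob) (hb : bob ≠ [])
    (hin : (S false).input = b) (hD : κ = none → D = fun _ _ => true) (hy : yields h < 3)
    {l : Log} {s m q : Bits} {st : Identity → Bits}
    (hst : d.StatesMatch alice κ (Function.update (fun w => (S w).log) v l) (yields h) st)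
    (hmem : ∀ w, κ = some w → st adversary =
      encodeMemory (Function.update (fun w => (S w).log) v l w, h)) :
    d.Realizes alice bob k a b κ D 3 S v h ⟨triple s environment m, q, st⟩
      (destOutcome alice bob v h (S v).input (l, .env (triple s environment m))) := by
  set σ : Config := ⟨triple s environment m, q, st⟩ with hσ
  have hp : parse σ.cls = some (s, environment, m) := parse_triple _ _ _
  have hZ := realNetwork_environment (d := d) (alice := alice) (bob := bob) (a := a) (b := b)
    (κ := κ) (D := D)
  have hstep : environmentStep alice bob a b κ.isSome ⟨σ.state environment, σ.cls, σ.qnt⟩ =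
      if triple s environment m = expected alice bob (yields h) then
        if κ.isSome then
          ⟨List.replicate (2 * yields h + 2) true, triple environment adversary [], []⟩
        else Regs.proceed bob b (yields h)
      else Regs.reject := by
    rw [show σ.state environment = _ from hst.env]
    exact environmentStep_waiting
  by_cases hc : triple s environment m = expected alice bob (yields h)
  · have hyields : yields (h ++ [none]) = yields h + 1 := by rw [yields_concat, if_pos rfl]
    simp only [destOutcome, hc, if_true, Realizes]
    rw [if_pos hc] at hstep
    rcases κ with _ | w
    · simp only [Option.isSome_none, Bool.false_eq_true, if_false] at hstep
      by_cases hy2 : yields h = 2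
      · have hacc : ∀ n, (d.realNetwork alice bob a b none D).accept k (n + 1) σ = 1 := fun n =>
          Network.accept_succ_output (out := [true]) hp hZ (by
            rw [Option.isSome_none, hstep, hy2]
            exact output_afterRun_accept _)
        refine Or.inr ⟨by rw [hyields]; omega, fun n => ?_, ?_⟩
        · simpa [verdict, hD rfl] using Network.accept_le_one
        · rw [hacc 2]
          simp [verdict, hD rfl]
      · refine Or.inl ⟨_, matches_nextMsg (v := v) (x := ⟨(S v).input, l, [], []⟩)
          hbob hab hin rfl (by omega)
          (hst.update_environment _) (fun w hw => by simp at hw), 1, by omega,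
          Network.Leads.of_pure hp hZ rfl ?_ (output_nextMsg hb _)⟩
        dsimp only
        rw [Option.isSome_none, hstep, afterRun_proceed hy2]
    · simp only [Option.isSome_some, if_true] at hstep
      -- the adversary is notified, and answers
      have hl₁ : (d.realNetwork alice bob a b (some w) D).Leads k 1 σ
          ⟨triple environment adversary [], [],
            Function.update st environment (List.replicate (2 * yields h + 2) true)⟩ :=
        Network.Leads.of_pure hp hZ rfl
          (by
            dsimp only
            rw [Option.isSome_some, hstep, Config.afterRun_eq]
            exact Config.dispatch_triple _ _ _ _ _)
          (by rw [Config.output_triple]; simp [adversary])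
      set st₁ := Function.update st environment (List.replicate (2 * yields h + 2) true)
        with hst₁
      set mem := encodeMemory (Function.update (fun w => (S w).log) v l w, h ++ [none]) with hm₁
      have hadv : st₁ adversary = encodeMemory (Function.update (fun w => (S w).log) v l w, h) := by
        rw [hst₁, Function.update_of_ne environment_ne_adversary.symm, hmem w rfl]
      have hl₂ : (d.realNetwork alice bob a b (some w) D).Leads k 1
          ⟨triple environment adversary [], [], st₁⟩
          ⟨triple adversary environment [D k (h ++ [none])], [],
            Function.update st₁ adversary mem⟩ :=
        Network.Leads.of_pure (parse_triple _ _ _) realNetwork_adversary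
          (by
            dsimp only
            rw [emulator]
            simp only [parse_triple, if_true]
            rw [hadv, decodeMemory_encodeMemory])
          (by
            rw [Config.afterRun_eq]
            exact Config.dispatch_triple _ _ _ _ _)
          (by rw [Config.output_triple]; simp [environment_ne_adversary.symm])
      set st₂ := Function.update st₁ adversary mem with hst₂
      set τ : Config := ⟨triple adversary environment [D k (h ++ [none])], [], st₂⟩ with hτ
      have hp' : parse τ.cls = some (adversary, environment, [D k (h ++ [none])]) :=
        parse_triple _ _ _
      have hstep' : environmentStep alice bob a b (some w).isSome
          ⟨τ.state environment, τ.cls, τ.qnt⟩ =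
          if yields h = 2 ∧ τ.cls ≠ triple adversary environment [true] then Regs.reject
          else Regs.proceed bob b (yields h) := by
        have : τ.state environment = List.replicate (2 * yields h + 2) true := by
          rw [hτ, hst₂, hst₁]
          simp [environment_ne_adversary]
        rw [this]
        exact environmentStep_asked
      have hcls : τ.cls ≠ triple adversary environment [true] ↔ D k (h ++ [none]) = false := by
        rw [hτ, Ne, triple_inj]
        simp
      simp only [hcls] at hstep'
      refine Reaches.of_leads (B := 1) (τ := τ) ?_ (hl₁.trans hl₂)
      by_cases hy2 : yields h = 2
      · have hacc : ∀ n, (d.realNetwork alice bob a b (some w) D).accept k (n + 1) τ =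
            verdict k D (h ++ [none]) := by
          intro n
          cases hDk : D k (h ++ [none])
          · refine (Network.accept_succ_output (out := [false]) hp' hZ ?_).trans ?_
            · rw [hstep', hDk, if_pos ⟨hy2, rfl⟩]
              exact output_afterRun_reject _
            · simp [verdict, hDk]
          · refine (Network.accept_succ_output (out := [true]) hp' hZ ?_).trans ?_
            · rw [hstep', hDk, if_neg (by simp), hy2]
              exact output_afterRun_accept _
            · simp [verdict, hDk]
        exact Or.inr ⟨by rw [hyields]; omega,
          fun n => (Network.accept_le_succ).trans (hacc n).le, (hacc 0).ge⟩
      · refine Or.inl ⟨_, matches_nextMsg (v := v) (x := ⟨(S v).input, l, [], []⟩)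
          hbob hab hin rfl (by omega)
          (st := Function.update st₂ environment (List.replicate (2 * (yields h + 1) + 1) true))
          ?_ ?_, 1, by omega, Network.Leads.of_pure hp' hZ rfl ?_ (output_nextMsg hb _)⟩
        · have : st₂ = Function.update (Function.update st adversary mem) environment
              (List.replicate (2 * yields h + 2) true) :=
            Function.update_comm environment_ne_adversary _ _ _
          rw [this, Function.update_idem]
          exact hst.update_environment' _ _
        · intro w' hw'
          obtain rfl : w = w' := by simpa using hw'
          rw [Function.update_of_ne environment_ne_adversary.symm, hst₂, Function.update_self]
        · dsimp only
          rw [hstep', if_neg (by simp [hy2]), afterRun_proceed hy2]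
  · simp only [destOutcome, hc, if_false, Realizes]
    intro n
    rcases n with _ | n
    · exact Network.accept_zero
    · refine (Network.accept_succ_output (out := [false]) hp hZ ?_).trans (by simp)
      rw [hstep, if_neg hc]
      exact output_afterRun_reject _

end HybridProtocol

namespace HybridProtocol

variable {π : Protocol} {d : HybridProtocol π} {alice bob : Identity} {k : ℕ} {a b : Bool}
  {κ : Option Bool} {D : ℕ → List Event → Bool} {S : Bool → Side} {v : Bool} {h : List Event}
  {σ : Config}

theorem yields_concat_some (h : List Event) (e : Bits × Bits) :
    yields (h ++ [some e]) = yields h := by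
  simp [yields_concat]

/-- A party is activated. -/
theorem realizes_party (hin : (S false).input = b) (hy : yields h < 3) (hv : activeSide h = v)
    {l : Log} {s j m q : Bits} {st : Identity → Bits} (hs : s ≠ adversary) (hj : j ∈ π.parties)
    (hsv : d.senderSide alice (triple s j m) = some v)
    (hst : d.StatesMatch alice κ (Function.update (fun w => (S w).log) v l) (yields h) st)
    (hmem : ∀ w, κ = some w → st adversary =
      encodeMemory (Function.update (fun w => (S w).log) v l w,
        if w = v then sent alice v h (.party (triple s j m) q j) else h)) :
    d.Realizes alice bob k a b κ D 0 S v h ⟨triple s j m, q, st⟩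
      (destOutcome alice bob v h (S v).input (l, .party (triple s j m) q j)) := by
  simp only [sent] at hmem
  by_cases hjv : ownSide alice j = v
  · simp only [destOutcome, hjv, if_true, Realizes]
    refine Or.inl ⟨_, ?_, 0, le_rfl, Network.Leads.refl _ _ _⟩
    exact {
      yields_lt := hy
      cls_eq := by simp [hv]
      qnt_eq := by simp [hv]
      input_eq := (update_input S v false _ (by rfl)).trans hin
      addressed := ⟨s, j, m, rfl, hs, hj, by rw [hv, hjv]⟩
      states := by simpa only [update_log] using hst
      memory := fun w hw => by
        refine ⟨h, ?_, ?_⟩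
        · rw [update_log]
          simpa [hjv] using hmem w hw
        · split_ifs with hvw
          · simp [receive, hsv, ← hvw, hv]
          · rfl }
  · have hjv' : ownSide alice j = !v := Bool.eq_not_of_ne hjv
    simp only [destOutcome, hjv, if_false, Realizes]
    refine Or.inl ⟨_, ?_, 0, le_rfl, Network.Leads.refl _ _ _⟩
    exact {
      yields_lt := by rwa [yields_concat_some]
      cls_eq := by simp [system]
      qnt_eq := by simp [system]
      input_eq := (upd_input _ _).trans ((update_input S v false _ (by rfl)).trans hin)
      addressed := ⟨s, j, m, rfl, hs, hj, by rw [activeSide_concat, hv, hjv']; rfl⟩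
      states := by
        rw [yields_concat_some]
        simpa only [upd_log, update_log] using hst
      memory := fun w hw => by
        refine ⟨if w = v then h ++ [some (triple s j m, q)] else h, ?_, ?_⟩
        · rw [upd_log, update_log]
          simpa [hjv] using hmem w hw
        · rw [activeSide_concat, hv]
          rcases Bool.eq_or_eq_not w v with rfl | rfl
          · simp
          · simp [receive, hsv] }

theorem senderSide_party {i j m : Bits} (hi : i ∈ π.parties) :
    d.senderSide alice (triple i j m) = some (ownSide alice i) := by
  simp [senderSide, parse_triple, hi]

theorem senderSide_comm {i j m : Bits} {c} (hc : d.comm i = some c) :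
    d.senderSide alice (triple i j m) = some (ownSide alice c.1) := by
  simp [senderSide, parse_triple, (comm_eq_some hc).1, hc]

theorem StatesMatch.of_comm {L : Bool → Log} {y : ℕ} {st : Identity → Bits} {j : Identity} {c}
    {s : Bits} (hst : d.StatesMatch alice κ (Function.update L v (L v)) y st)
    (hc : d.comm j = some c) (hv : ownSide alice c.1 = v) :
    d.StatesMatch alice κ (Function.update L v ((j, s) :: L v)) y (Function.update st j s) where
  env := by rw [Function.update_of_ne (comm_eq_some hc).2.1.symm, hst.env]
  party i hi hκ := by
    have hij : i ≠ j := by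
      rintro rfl
      exact (comm_eq_some hc).1 hi
    rw [Function.update_of_ne hij, hst.party i hi hκ]
    rcases eq_or_ne (ownSide alice i) v with h | h
    · simp [h, Log.get_cons, hij]
    · simp [h]
  comm i c' hc' := by
    rcases eq_or_ne i j with rfl | hij
    · obtain rfl : c' = c := by simpa [hc] using hc'.symm
      simp [hv, Log.get_cons]
    · rw [Function.update_of_ne hij, hst.comm i c' hc']
      rcases eq_or_ne (ownSide alice c'.1) v with h | h
      · simp [h, Log.get_cons, hij]
      · simp [h]

/-- A party of side `v` has halted with `r`, and the local states are `st`. -/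
theorem realizes_dispatch (hbob : bob ∈ π.parties) (hab : alice ≠ bob) (hb : bob ≠ [])
    (hin : (S false).input = b) (hD : κ = none → D = fun _ _ => true)
    (hy : yields h < 3) (hv : activeSide h = v)
    {i : Identity} (hi : i ∈ π.parties) (hiv : ownSide alice i = v) {r : Regs}
    {st : Identity → Bits}
    (hst : d.StatesMatch alice κ (Function.update (fun w => (S w).log) v
      ((i, r.state) :: (S v).log)) (yields h) st)
    (hmem : ∀ w, κ = some w → st adversary =
      encodeMemory (Function.update (fun w => (S w).log) v (d.route k i (S v).log r).1 w,
        if w = v then sent alice v h (d.route k i (S v).log r).2 else h))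
    (hr : κ = some v → ∀ m, r.cls ≠ triple i adversary m) :
    d.Realizes alice bob k a b κ D 4 S v h (Config.dispatch i st r.cls r.qnt)
      (destOutcome alice bob v h (S v).input (d.route k i (S v).log r)) := by
  have henv : ∀ {l : Log}, d.route k i (S v).log r = (l, .env emptyMsg) →
      ∀ {st' : Identity → Bits}, st' adversary = st adversary →
      d.StatesMatch alice κ (Function.update (fun w => (S w).log) v l) (yields h) st' →
      d.Realizes alice bob k a b κ D 3 S v h (Config.reset st')
        (destOutcome alice bob v h (S v).input (d.route k i (S v).log r)) := by
    intro l hl st' hst' hst'l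
    rw [hl] at hmem ⊢
    refine realizes_env hbob hab hb hin hD hy hst'l fun w hw => ?_
    rw [hst', hmem w hw]
    simp [sent]
  rcases Config.dispatch_cases i st r.cls r.qnt with ⟨j, m, hcls, hdisp⟩ | ⟨hcls, hdisp⟩
  swap
  · rw [hdisp]
    refine (henv (l := (i, r.state) :: (S v).log) ?_ rfl hst).mono (by omega)
    unfold route
    rcases hp : parse r.cls with _ | ⟨s, j, m⟩
    · rfl
    · have := triple_of_parse _ _ _ _ hp
      have hs : s ≠ i := by
        rintro rfl
        exact hcls j m this
      simp [hs]
  have hie := (Protocol.ne_of_mem hi).1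
  have hout : ∀ st' : Identity → Bits, (⟨r.cls, r.qnt, st'⟩ : Config).output = none := by
    intro st'
    rw [hcls, Config.output_triple]
    simp [hie]
  rw [hdisp]
  have hp : parse r.cls = some (i, j, m) := by rw [hcls, parse_triple]
  by_cases hje : j = environment
  · subst hje
    have hroute : d.route k i (S v).log r = ((i, r.state) :: (S v).log, .env r.cls) := by
      simp [route, hp]
    rw [hroute] at hmem ⊢
    rw [hcls] at hmem ⊢
    refine (realizes_env hbob hab hb hin hD hy hst fun w hw => ?_).mono (by omega)
    simpa [sent] using hmem w hw
  by_cases hj : j ∈ π.parties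
  · have hroute : d.route k i (S v).log r =
        ((i, r.state) :: (S v).log, .party r.cls r.qnt j) := by
      simp [route, hp, hje, hj]
    rw [hroute] at hmem ⊢
    rw [hcls] at hmem ⊢
    refine (realizes_party hin hy hv (Protocol.ne_of_mem hi).2 hj ?_ hst hmem).mono (by omega)
    rw [senderSide_party hi, hiv]
  rcases hc : d.comm j with _ | ⟨sender, recipient, ℓ⟩
  · have hroute : d.route k i (S v).log r = ((i, r.state) :: (S v).log, .env emptyMsg) := by
      simp [route, hp, hje, hj, hc]
    refine (henv hroute rfl hst).of_leads (j := 1) ?_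
    by_cases hja : j = adversary
    · subst hja
      have hκ : κ ≠ some (ownSide alice i) := fun hκ => hr (hiv ▸ hκ) m hcls
      refine Network.Leads.of_pure hp realNetwork_adversary
        (r := ⟨st adversary, [], []⟩) ?_ ?_ (Config.output_reset _)
      · simp [emulator, hp, hie, hκ]
      · rw [Config.afterRun_eq, Config.dispatch_nil, Function.update_eq_self]
    · intro n
      exact Network.accept_succ_none hp (by rw [realNetwork_of_notMem hj hje hja, hc]; rfl)
  · have hja := (comm_eq_some hc).2.2
    have hN : d.realNetwork alice bob a b κ D j = some (commitment j sender recipient ℓ) := by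
      rw [realNetwork_of_notMem hj hje hja, hc]; rfl
    by_cases hs : sender = i
    · subst hs
      set r' := commitmentStep j sender recipient ℓ k
        ⟨Log.get ((sender, r.state) :: (S v).log) j, r.cls, r.qnt⟩ with hr'
      have hroute : d.route k sender (S v).log r = ((j, r'.state) :: (sender, r.state) :: (S v).log,
          if r'.cls = [] then .env emptyMsg else .party r'.cls [] recipient) := by
        simp only [route, hp, hje, hj, hc]
        simp [hr']
      have hstj : st j = Log.get ((sender, r.state) :: (S v).log) j := by
        rw [hst.comm j _ hc]
        simp [hiv]
      have hst' : d.StatesMatch alice κ (Function.update (fun w => (S w).log) v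
          ((j, r'.state) :: (sender, r.state) :: (S v).log)) (yields h)
          (Function.update st j r'.state) := by
        have := StatesMatch.of_comm (v := v) (s := r'.state)
          (L := Function.update (fun w => (S w).log) v ((sender, r.state) :: (S v).log))
          (by simpa using hst) hc hiv
        simpa using this
      have hadv : Function.update st j r'.state adversary = st adversary :=
        Function.update_of_ne hja.symm _ _
      have hstep : commitmentStep j sender recipient ℓ k ⟨st j, r.cls, r.qnt⟩ = r' := by
        rw [hstj]
      obtain ⟨hq, hm⟩ := commitmentStep_message j sender recipient ℓ k
        ⟨Log.get ((sender, r.state) :: (S v).log) j, r.cls, r.qnt⟩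
      rw [← hr'] at hq hm
      rcases hm with hm | ⟨m', hm⟩
      · rw [if_pos hm] at hroute
        refine (henv hroute hadv hst').of_leads (j := 1) ?_
        refine Network.Leads.of_pure hp hN rfl ?_ (Config.output_reset _)
        dsimp only
        rw [hstep, Config.afterRun_eq, hm, Config.dispatch_nil]
      · rw [if_neg (by rw [hm]; exact triple_ne_nil _ _ _), hm] at hroute
        rw [hroute] at hmem ⊢
        refine ((realizes_party hin hy hv hja (d.recipient_mem j _ hc) ?_ hst'
          (fun w hw => hadv.trans (hmem w hw))).of_leads (j := 1) ?_).mono (by omega)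
        · rw [senderSide_comm hc, hiv]
        · refine Network.Leads.of_pure hp hN rfl ?_ ?_
          · dsimp only
            rw [hstep, Config.afterRun_eq, hm, hq, Config.dispatch_triple]
          · rw [Config.output_triple]
            simp [hje]
    · have hroute : d.route k i (S v).log r = ((i, r.state) :: (S v).log, .env emptyMsg) := by
        simp [route, hp, hje, hj, hc, hs]
      refine (henv hroute rfl hst).of_leads (j := 1) ?_
      refine Network.Leads.of_pure hp hN rfl ?_ (Config.output_reset _)
      dsimp only
      rw [hcls, commitmentStep_of_ne (Ne.symm hs), Config.afterRun_eq, Config.dispatch_nil,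
        Function.update_eq_self]

end HybridProtocol

namespace HybridProtocol

variable {π : Protocol} {d : HybridProtocol π} {alice bob : Identity} {k : ℕ} {a b : Bool}
  {κ : Option Bool} {D : ℕ → List Event → Bool} {S : Bool → Side} {v : Bool} {h : List Event}
  {σ : Config}

theorem StatesMatch.of_party {L : Bool → Log} {y : ℕ} {st st' : Identity → Bits} {i : Identity}
    {s : Bits} (hst : d.StatesMatch alice κ L y st) (hi : i ∈ π.parties)
    (hv : ownSide alice i = v) (hst' : ∀ j, j ≠ i → j ≠ adversary → st' j = st j)
    (hs : κ ≠ some v → st' i = s) :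
    d.StatesMatch alice κ (Function.update L v ((i, s) :: L v)) y st' where
  env := by rw [hst' _ (Protocol.ne_of_mem hi).1.symm environment_ne_adversary, hst.env]
  party j hj hκ := by
    rcases eq_or_ne j i with rfl | hji
    · simp [hv, Log.get_cons, hs (hv ▸ hκ)]
    · rw [hst' j hji (Protocol.ne_of_mem hj).2, hst.party j hj hκ]
      rcases eq_or_ne (ownSide alice j) v with h | h
      · simp [h, Log.get_cons, hji]
      · simp [h]
  comm j c hc := by
    have hji : j ≠ i := by
      rintro rfl
      exact (comm_eq_some hc).1 hi
    rw [hst' j hji (comm_eq_some hc).2.2, hst.comm j c hc]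
    rcases eq_or_ne (ownSide alice c.1) v with h | h
    · simp [h, Log.get_cons, hji]
    · simp [h]

/-- An activation of a side of the two-sided system takes one step in the real network, if the side
is honest. If it is corrupted, the message has to be forwarded to the adversary first. -/
theorem Matches.step (hbob : bob ∈ π.parties) (hab : alice ≠ bob) (hb : bob ≠ [])
    (hD : κ = none → D = fun _ _ => true) (hM : d.Matches alice b κ S h σ)
    (hv : activeSide h = v) :
    ∃ (τ : Regs → Config) (j : ℕ), 1 ≤ j ∧ j ≤ 2 ∧
      (∀ n, (d.realNetwork alice bob a b κ D).accept k (n + j) σ =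
        ∑' r, d.sideDist k (S v) r * (d.realNetwork alice bob a b κ D).accept k n (τ r)) ∧
      ∀ r, d.Realizes alice bob k a b κ D 5 S v h (τ r)
        ((d.system alice bob k).out v h (S v) r) := by
  subst hv
  obtain ⟨s, i, m, hcls, hs, hi, hiv⟩ := hM.addressed
  have hp : parse σ.cls = some (s, i, m) := by rw [hcls, parse_triple]
  obtain ⟨hie, hia⟩ := Protocol.ne_of_mem hi
  have hout : ∀ r, (d.system alice bob k).out (activeSide h) h (S (activeSide h)) r =
      destOutcome alice bob (activeSide h) h (S (activeSide h)).input
        (d.route k i (S (activeSide h)).log r) := by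
    intro r
    simp [system, ← hM.cls_eq, hp]
  have hdist : d.sideDist k (S (activeSide h)) =
      d.program i k ⟨Log.get (S (activeSide h)).log i, σ.cls, σ.qnt⟩ := by
    simp [sideDist, ← hM.cls_eq, ← hM.qnt_eq, hp]
  set v := activeSide h with hv
  by_cases hκ : κ = some v
  · obtain ⟨h', hadv, hrec⟩ := hM.memory v hκ
    rw [if_pos rfl] at hrec
    have hcor : d.realNetwork alice bob a b κ D i = some (corruptionParty i) :=
      realNetwork_corrupted hi (by rw [hκ, hiv])
    have hl : (d.realNetwork alice bob a b κ D).Leads k 1 σ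
        ⟨triple i adversary σ.cls, σ.qnt, σ.state⟩ :=
      Network.Leads.of_pure hp hcor rfl
        (by
          simp only [hp, hs, if_false]
          rw [Config.afterRun_eq, Config.dispatch_triple, Function.update_eq_self])
        (by rw [Config.output_triple]; simp [hie])
    refine ⟨fun r => Config.afterRun adversary σ.state (d.reply alice k v i (S v).log h r), 2,
      by omega, le_rfl, fun n => ?_, fun r => ?_⟩
    · have hA : d.emulator alice κ D k ⟨σ.state adversary, triple i adversary σ.cls, σ.qnt⟩ =
          (d.sideDist k (S v)).map (d.reply alice k v i (S v).log h) := by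
        simp only [emulator, parse_triple, hie, if_false, hi, hiv, hκ, and_self, if_true, hadv,
          decodeMemory_encodeMemory, hrec, hdist]
      rw [show n + 2 = (n + 1) + 1 from rfl, hl (n + 1),
        Network.accept_succ_machine (parse_triple _ _ _) realNetwork_adversary hA]
      refine tsum_congr fun r => ?_
      rw [Network.acceptNow_of_none]
      rw [Config.afterRun_eq]
      exact Config.output_dispatch environment_ne_adversary.symm _ _ _
    · dsimp only
      rw [hout]
      set st := Function.update σ.state adversary
        (encodeMemory ((d.route k i (S v).log r).1, sent alice v h (d.route k i (S v).log r).2))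
        with hst
      have hstates : d.StatesMatch alice κ (Function.update (fun w => (S w).log) v
          ((i, r.state) :: (S v).log)) (yields h) st := by
        refine hM.states.of_party (i := i) hi hiv (fun j _ hj => ?_) (fun h => absurd hκ h)
        rw [hst, Function.update_of_ne hj]
      by_cases hr : ∃ m, r.cls = triple i adversary m
      · have : Config.afterRun adversary σ.state (d.reply alice k v i (S v).log h r) =
            Config.reset st := by
          rw [Config.afterRun_eq, reply, if_pos hr, Config.dispatch_nil]
        rw [this]
        obtain ⟨m', hr⟩ := hr
        have hroute : d.route k i (S v).log r = ((i, r.state) :: (S v).log, .env emptyMsg) := by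
          have hc : d.comm adversary = none := by
            rcases hc : d.comm adversary with _ | c
            · rfl
            · exact absurd rfl (comm_eq_some hc).2.2
          simp [route, hr, parse_triple, environment_ne_adversary.symm, π.reserved_notMem.2, hc]
        rw [hroute] at hst ⊢
        refine (realizes_env hbob hab hb hM.input_eq hD hM.yields_lt hstates
          fun w hw => ?_).mono (by omega)
        obtain rfl : v = w := by simpa [hκ] using hw
        rw [hst]
        simp [sent]
      · have heq : Config.afterRun adversary σ.state (d.reply alice k v i (S v).log h r) =
            ⟨triple adversary i r.cls, r.qnt, st⟩ := by
          rw [Config.afterRun_eq, reply, if_neg hr, Config.dispatch_triple]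
        rw [heq]
        have hl' : (d.realNetwork alice bob a b κ D).Leads k 1
            ⟨triple adversary i r.cls, r.qnt, st⟩ (Config.dispatch i st r.cls r.qnt) :=
          Network.Leads.of_pure (parse_triple _ _ _) hcor rfl
            (by
              simp only [parse_triple, if_true]
              rw [Config.afterRun_eq, Function.update_eq_self])
            (Config.output_dispatch hie _ _ _)
        refine (realizes_dispatch hbob hab hb hM.input_eq hD hM.yields_lt rfl hi hiv hstates
          (fun w hw => ?_) (fun _ m hm => hr ⟨m, hm⟩)).of_leads hl'
        obtain rfl : v = w := by simpa [hκ] using hw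
        rw [hst]
        simp [← hv]
  · refine ⟨fun r => Config.afterRun i σ.state r, 1, le_rfl, by omega, fun n => ?_, fun r => ?_⟩
    · have hst := hM.states.party i hi (by rwa [hiv])
      rw [hiv] at hst
      have hN : d.realNetwork alice bob a b κ D i = some (d.program i) :=
        realNetwork_honest hi (by rwa [hiv])
      rw [Network.accept_succ_machine (p := d.sideDist k (S v)) (g := id) hp hN
        (by rw [hdist, PMF.map_id, hst])]
      refine tsum_congr fun r => ?_
      rw [Network.acceptNow_of_none]
      · rfl
      · rw [Config.afterRun_eq]
        exact Config.output_dispatch hie _ _ _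
    · dsimp only
      rw [hout, Config.afterRun_eq]
      refine (realizes_dispatch hbob hab hb hM.input_eq hD hM.yields_lt rfl hi hiv ?_
        (fun w hw => ?_) (fun h => absurd h hκ)).mono (by omega)
      · refine hM.states.of_party (i := i) hi hiv (fun j hj _ => ?_) (fun _ => ?_)
        · rw [Function.update_of_ne hj]
        · rw [Function.update_self]
      · obtain ⟨h', hadv, hh'⟩ := hM.memory w hw
        have hwv : v ≠ w := by
          rintro rfl
          exact hκ hw
        rw [if_neg hwv] at hh'
        rw [Function.update_of_ne hia.symm, hadv, hh', if_neg hwv.symm,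
          Function.update_of_ne hwv.symm]

theorem system_turn (hy : yields h < 3) :
    (d.system alice bob k).turn h = some (activeSide h) := by
  simp [system, hy]

theorem system_turn_none (hy : 3 ≤ yields h) : (d.system alice bob k).turn h = none := by
  simp [system, hy]

theorem Matches.accept_le_value (hbob : bob ∈ π.parties) (hab : alice ≠ bob) (hb : bob ≠ [])
    (hD : κ = none → D = fun _ _ => true) (n : ℕ) (hM : d.Matches alice b κ S h σ) :
    (d.realNetwork alice bob a b κ D).accept k n σ ≤
      (d.system alice bob k).value (verdict k D) n S h := by
  induction n generalizing S h σ with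
  | zero => simp [Network.accept_zero]
  | succ n ih =>
    obtain ⟨τ, j, hj, -, hacc, hτ⟩ := hM.step (a := a) hbob hab hb hD rfl
    refine (Network.accept_mono (show n + 1 ≤ n + j by omega)).trans ?_
    dsimp only
    rw [hacc, TwoSided.value_succ (system_turn hM.yields_lt)]
    refine ENNReal.tsum_le_tsum fun r => ?_
    refine mul_le_mul_right ?_ _
    have hreach : ∀ {S' h' τ}, d.Reaches alice bob k a b κ D 5 S' h' τ →
        (d.realNetwork alice bob a b κ D).accept k n τ ≤
          (d.system alice bob k).value (verdict k D) n S' h' := by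
      rintro S' h' τ (⟨υ, hυ, i, -, hl⟩ | ⟨hy, h₁, -⟩)
      · exact (hl.accept_le n).trans (ih hυ)
      · rw [TwoSided.value_of_turn_none (system_turn_none hy)]
        exact h₁ n
    have := hτ r
    revert this
    generalize (d.system alice bob k).out (activeSide h) h (S (activeSide h)) r = o
    intro ho
    cases o with
    | internal x => exact hreach ho
    | event e x => exact hreach ho
    | dead => exact (ho n).le

theorem Matches.value_le_accept (hbob : bob ∈ π.parties) (hab : alice ≠ bob) (hb : bob ≠ [])
    (hD : κ = none → D = fun _ _ => true) (n : ℕ) (hM : d.Matches alice b κ S h σ) :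
    (d.system alice bob k).value (verdict k D) n S h ≤
      (d.realNetwork alice bob a b κ D).accept k (7 * n) σ := by
  induction n generalizing S h σ with
  | zero => simp [TwoSided.value, system_turn hM.yields_lt]
  | succ n ih =>
    obtain ⟨τ, j, -, hj, hacc, hτ⟩ := hM.step (a := a) hbob hab hb hD rfl
    refine le_trans ?_ (Network.accept_mono (show (7 * n + 5) + j ≤ 7 * (n + 1) by omega))
    dsimp only
    rw [hacc, TwoSided.value_succ (system_turn hM.yields_lt)]
    refine ENNReal.tsum_le_tsum fun r => ?_
    refine mul_le_mul_right ?_ _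
    have hreach : ∀ {S' h' τ}, d.Reaches alice bob k a b κ D 5 S' h' τ →
        (d.system alice bob k).value (verdict k D) n S' h' ≤
          (d.realNetwork alice bob a b κ D).accept k (7 * n + 5) τ := by
      rintro S' h' τ (⟨υ, hυ, i, hi, hl⟩ | ⟨hy, -, h₂⟩)
      · refine (ih hυ).trans ?_
        rw [← hl]
        exact Network.accept_mono (by omega)
      · rw [TwoSided.value_of_turn_none (system_turn_none hy)]
        exact h₂.trans (Network.accept_mono (by omega))
    have := hτ r
    revert this
    generalize (d.system alice bob k).out (activeSide h) h (S (activeSide h)) r = o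
    intro ho
    cases o with
    | internal x => exact hreach ho
    | event e x => exact hreach ho
    | dead => exact zero_le

theorem matches_initial (halice : alice ∈ π.parties) :
    d.Matches alice b κ (initial alice a b) []
      ⟨triple environment alice [a], [], Function.update (fun _ => []) environment [true]⟩ where
  yields_lt := by simp [yields]
  cls_eq := rfl
  qnt_eq := rfl
  input_eq := rfl
  addressed := ⟨environment, alice, [a], rfl, environment_ne_adversary, halice,
    by simp [ownSide, activeSide]⟩
  states := {
    env := by simp [yields]
    party := fun i hi _ => by
      dsimp only
      rw [Function.update_of_ne (Protocol.ne_of_mem hi).1]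
      cases ownSide alice i <;> rfl
    comm := fun i c hc => by
      dsimp only
      rw [Function.update_of_ne (comm_eq_some hc).2.1]
      cases ownSide alice c.1 <;> rfl }
  memory w _ := by
    refine ⟨[], ?_, ?_⟩
    · dsimp only
      rw [Function.update_of_ne environment_ne_adversary.symm]
      cases w <;> exact encodeMemory_nil.symm
    · split_ifs
      · simp [receive, senderSide, parse_triple, π.reserved_notMem.1, comm_environment]
      · rfl

/-- The first step of any network with the test environment. -/
theorem leads_init {N : Network} {ask : Bool} (halice : alice ≠ [])
    (hN : N environment = some (testEnvironment alice bob a b ask)) :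
    N.Leads k 1 (Config.init [])
      ⟨triple environment alice [a], [], Function.update (fun _ => []) environment [true]⟩ :=
  Network.Leads.of_pure (parse_triple _ _ _) hN rfl
    (by
      rw [Config.afterRun_eq]
      exact Config.dispatch_triple _ _ _ _ _)
    (by rw [Config.output_triple]; simp [halice])

/-- The real network returns `1` with the probability that the honest protocol has a transcript that
the adversary accepts. -/
theorem iSup_accept_realNetwork (halice : alice ∈ π.parties) (hbob : bob ∈ π.parties)
    (hab : alice ≠ bob) (ha : alice ≠ []) (hb : bob ≠ []) (hD : κ = none → D = fun _ _ => true) :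
    ⨆ n, (d.realNetwork alice bob a b κ D).accept k n (Config.init []) =
      ∑' t, verdict k D t * d.runProb alice bob k a b t := by
  have hM := matches_initial (d := d) (a := a) (b := b) (κ := κ) halice
  rw [(leads_init ha realNetwork_environment).iSup_accept]
  refine Eq.trans ?_ (TwoSided.iSup_value (d.system alice bob k) (verdict k D)
    (initial alice a b) [])
  refine le_antisymm (iSup_mono fun n => hM.accept_le_value hbob hab hb hD n)
    (iSup_le fun n => (hM.value_le_accept (a := a) hbob hab hb hD n).trans ?_)
  exact le_iSup (fun n => (d.realNetwork alice bob a b κ D).accept k n _) (7 * n)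

end HybridProtocol

/-! ### The ideal network -/

section Ideal

variable {alice bob f : Identity}

/-- The ideal protocol for the AND functionality, with corrupted parties `C`, simulator `S`, and
the test environment. -/
noncomputable def idealNetwork (π : Protocol) (f alice bob : Identity)
    (hf : f ≠ environment ∧ f ≠ adversary) (C : Set Identity) (S : Machine) (a b ask : Bool) :
    Network :=
  (idealProtocol π.parties f (andFunctionality f alice bob) hf π.reserved_notMem).network C S
    (testEnvironment alice bob a b ask)

variable {π : Protocol} {hf : f ≠ environment ∧ f ≠ adversary} {C : Set Identity} {S : Machine}
  {a b ask : Bool}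

theorem idealNetwork_environment :
    idealNetwork π f alice bob hf C S a b ask environment =
      some (testEnvironment alice bob a b ask) := by
  simp [idealNetwork, Protocol.network]

theorem idealNetwork_functionality (hfC : f ∉ C) :
    idealNetwork π f alice bob hf C S a b ask f = some (andFunctionality f alice bob) := by
  simp [idealNetwork, Protocol.network, hf.1, hf.2, hfC, idealProtocol]

theorem idealNetwork_honest {i : Identity} (hi : i ∈ π.parties) (hC : i ∉ C)
    (hfp : f ∉ π.parties) :
    idealNetwork π f alice bob hf C S a b ask i = some (dummyParty f i) := by
  have hif : i ≠ f := fun h => hfp (h ▸ hi)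
  have := Protocol.ne_of_mem hi
  simp [idealNetwork, Protocol.network, this, hC, idealProtocol, hif, hi]

theorem idealNetwork_congr {i : Identity} (hi : i ≠ environment) (a' b' : Bool) :
    idealNetwork π f alice bob hf C S a b ask i =
      idealNetwork π f alice bob hf C S a' b' ask i := by
  simp [idealNetwork, Protocol.network, hi]

variable {N : Network} {k : ℕ} {i : Identity} {st : Identity → Bits} {m q : Bits}

theorem leads_dummyParty_of_environment (hN : N i = some (dummyParty f i)) (hi : i ≠ environment) :
    N.Leads k 1 ⟨triple environment i m, q, st⟩ ⟨triple i f m, q, st⟩ :=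
  Network.Leads.of_pure (parse_triple _ _ _) hN rfl
    (by
      simp only [parse_triple, if_true]
      rw [Config.afterRun_eq, Config.dispatch_triple, Function.update_eq_self])
    (by rw [Config.output_triple]; simp [hi])

theorem leads_dummyParty_of_functionality (hN : N i = some (dummyParty f i))
    (hi : i ≠ environment) (hf : f ≠ environment) :
    N.Leads k 1 ⟨triple f i m, q, st⟩ ⟨triple i environment m, q, st⟩ :=
  Network.Leads.of_pure (parse_triple _ _ _) hN rfl
    (by
      simp only [parse_triple, hf, if_false, if_true]
      rw [Config.afterRun_eq, Config.dispatch_triple, Function.update_eq_self])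
    (by rw [Config.output_triple]; simp [hi])

theorem leads_functionality (hN : N f = some (andFunctionality f alice bob)) (hf : f ≠ environment)
    {r : Regs} (hr : andStep f alice bob ⟨st f, triple i f m, q⟩ = r) :
    N.Leads k 1 ⟨triple i f m, q, st⟩
      (Config.dispatch f (Function.update st f r.state) r.cls r.qnt) :=
  Network.Leads.of_pure (parse_triple _ _ _) hN rfl (by dsimp only; rw [hr]; rfl)
    (Config.output_dispatch hf _ _ _)

variable (f) in
/-- The local states in a run where only the environment and the functionality `f` keep data. -/
def idealStates (e s : Bits) : Identity → Bits :=
  Function.update (Function.update (fun _ => []) environment e) f s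

theorem leads_testEnvironment (hN : N environment = some (testEnvironment alice bob a b ask))
    (hf : f ≠ environment) {e s j : Bits} (hj : j ≠ []) {e' m' : Bits}
    (h : environmentStep alice bob a b ask ⟨e, triple i environment m, q⟩ =
      ⟨e', triple environment j m', []⟩) :
    N.Leads k 1 ⟨triple i environment m, q, idealStates f e s⟩
      ⟨triple environment j m', [], idealStates f e' s⟩ :=
  Network.Leads.of_pure (parse_triple _ _ _) hN rfl
    (by
      have he : idealStates f e s environment = e := by simp [idealStates, hf.symm]
      simp only [he, h]
      rw [Config.afterRun_eq, Config.dispatch_triple, idealStates,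
        Function.update_comm hf, Function.update_idem]
      rfl)
    (by rw [Config.output_triple]; simp [hj])

theorem idealStates_self (e s : Bits) : idealStates f e s f = s := by simp [idealStates]

theorem update_idealStates (e s s' : Bits) :
    Function.update (idealStates f e s) f s' = idealStates f e s' := by
  simp [idealStates]

/-- If nobody is corrupted, the ideal network gives the environment Alice's and Bob's results in the
expected order. -/
theorem iSup_accept_idealNetwork (hfe : f ≠ environment) (ha : alice ≠ []) (hb : bob ≠ [])
    (hab : alice ≠ bob) (hae : alice ≠ environment) (hbe : bob ≠ environment)
    (hZ : N environment = some (testEnvironment alice bob a b false))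
    (hF : N f = some (andFunctionality f alice bob))
    (hA : N alice = some (dummyParty f alice)) (hB : N bob = some (dummyParty f bob)) :
    ⨆ n, N.accept k n (Config.init []) = if a && b then 0 else 1 := by
  set s₁ := AndState.encode ⟨some a, none, false, false⟩ with hs₁
  set s₂ := AndState.encode ⟨some a, some b, true, false⟩ with hs₂
  set s₃ := AndState.encode ⟨some a, some b, true, true⟩ with hs₃
  have l₁ := HybridProtocol.leads_init (k := k) ha hZ
  have h₁ : (⟨triple environment alice [a], [], Function.update (fun _ => []) environment [true]⟩ :
      Config) = ⟨triple environment alice [a], [], idealStates f [true] []⟩ := by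
    congr 1
    exact (Function.update_eq_self_iff.mpr (by simp [hfe])).symm
  rw [h₁] at l₁
  have l₂ := l₁.trans (leads_dummyParty_of_environment hA hae)
  have l₃ := l₂.trans (leads_functionality (r := ⟨s₁, [], []⟩) hF hfe (by
    rw [idealStates_self]
    simp [andStep, parse_triple, AndState.decode_nil, AndState.record, bitOf, AndState.send, hs₁]))
  rw [update_idealStates, Config.dispatch_nil] at l₃
  have l₄ := l₃.trans (leads_testEnvironment (e' := [true, true, true]) (m' := [b]) hZ hfe hb (by
    simp [environmentStep, expected, emptyMsg, Regs.proceed, nextMsg, List.replicate]))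
  have l₅ := l₄.trans (leads_dummyParty_of_environment hB hbe)
  have l₆ := l₅.trans (leads_functionality (r := ⟨s₂, triple f alice [a && b], []⟩) hF hfe (by
    rw [idealStates_self]
    simp [andStep, parse_triple, hs₁, AndState.decode_encode, AndState.record, bitOf,
      AndState.send, hs₂, hab.symm]))
  rw [update_idealStates, Config.dispatch_triple] at l₆
  have l₇ := l₆.trans (leads_dummyParty_of_functionality hA hae hfe)
  cases hc : a && b
  · rw [hc] at l₇
    have l₈ := l₇.trans (leads_testEnvironment (e' := [true, true, true, true, true]) (m' := []) hZ
      hfe hb (by simp [environmentStep, expected, Regs.proceed, nextMsg, List.replicate]))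
    have l₉ := l₈.trans (leads_dummyParty_of_environment hB hbe)
    have l₁₀ := l₉.trans (leads_functionality (r := ⟨s₃, triple f bob [false], []⟩) hF hfe (by
      rw [idealStates_self, hs₂]
      simp [andStep, parse_triple, AndState.decode_encode, AndState.record, bitOf,
        AndState.send, hs₃, hab.symm]
      rw [hc]))
    rw [update_idealStates, Config.dispatch_triple] at l₁₀
    have l₁₁ := l₁₀.trans (leads_dummyParty_of_functionality hB hbe hfe)
    rw [l₁₁.iSup_accept]
    refine le_antisymm (iSup_le fun n => Network.accept_le_one) (le_iSup_of_le 1 ?_)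
    rw [Network.accept_succ_output (out := [true]) (parse_triple _ _ _) hZ]
    · simp
    · have : environmentStep alice bob a b false ⟨[true, true, true, true, true],
          triple bob environment [false], []⟩ = Regs.proceed bob b 2 := by
        simp [environmentStep, expected]
      simp only [idealStates, Function.update_of_ne hfe.symm, Function.update_self, this]
      exact output_afterRun_accept _
  · rw [hc] at l₇
    rw [l₇.iSup_accept]
    refine le_antisymm (iSup_le fun n => ?_) zero_le
    rcases n with _ | n
    · exact Network.accept_zero.le
    rw [Network.accept_succ_output (out := [false]) (parse_triple _ _ _) hZ]
    · simp
    · have : environmentStep alice bob a b false ⟨[true, true, true],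
          triple alice environment [true], []⟩ = Regs.reject := by
        simp [environmentStep, expected, triple_inj]
      simp only [idealStates, Function.update_of_ne hfe.symm, Function.update_self, this]
      exact output_afterRun_reject _

end Ideal

/-! ### The AND functionality on related inputs -/

namespace AndState

variable {alice bob f : Identity} {p : Bool} {σ σ' : AndState}

/-- The input of the honest party, which is Alice if `p`, and Bob otherwise. -/
def own (p : Bool) (σ : AndState) : Option Bool := if p then σ.inputA else σ.inputB

/-- The input of the other one of the two parties. -/
def other (p : Bool) (σ : AndState) : Option Bool := if p then σ.inputB else σ.inputA

/-- The identity of the honest party. -/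
def honestParty (alice bob : Identity) (p : Bool) : Identity := if p then alice else bob

/-- The states `σ` and `σ'` of the AND functionality agree, except that the input of the honest
party is `1` in `σ` and `0` in `σ'` if it is known. The other input is not `1` then. -/
structure Coupled (p : Bool) (σ σ' : AndState) : Prop where
  other_eq : σ.other p = σ'.other p
  sentA_eq : σ.sentA = σ'.sentA
  sentB_eq : σ.sentB = σ'.sentB
  own : σ.own p = none ∧ σ'.own p = none ∨
    σ.own p = some true ∧ σ'.own p = some false ∧ σ.other p ≠ some true

theorem coupled_iff : Coupled p σ σ' ↔ σ.other p = σ'.other p ∧ σ.sentA = σ'.sentA ∧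
    σ.sentB = σ'.sentB ∧ (σ.own p = none ∧ σ'.own p = none ∨
      σ.own p = some true ∧ σ'.own p = some false ∧ σ.other p ≠ some true) :=
  ⟨fun h => ⟨h.1, h.2, h.3, h.4⟩, fun h => ⟨h.1, h.2.1, h.2.2.1, h.2.2.2⟩⟩

/-- The honest party has input `1`, and the other one has input `0`. -/
def Settled (p : Bool) (σ : AndState) : Prop := σ.own p = some true ∧ σ.other p = some false

/-- Both inputs are `1`. -/
def Dead (σ : AndState) : Prop := σ.inputA = some true ∧ σ.inputB = some true

theorem Dead.record {s m : Bits} (h : σ.Dead) : (σ.record alice bob s m).Dead := by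
  obtain ⟨h₁, h₂⟩ := h
  unfold AndState.record
  split_ifs <;> simp [Dead, h₁, h₂]

theorem Dead.send (h : σ.Dead) : (decode (σ.send f alice bob).state).Dead ∧
    ((σ.send f alice bob).cls = [] ∨ ∃ i, (σ.send f alice bob).cls = triple f i [true]) := by
  rcases σ with ⟨x, y, u, v⟩
  obtain ⟨h₁, h₂⟩ := h
  dsimp only at h₁ h₂
  subst h₁ h₂
  cases u <;> cases v <;> simp [AndState.send, Dead, decode_encode, triple_inj]

theorem Coupled.send (h : Coupled p σ σ') :
    Coupled p (decode (σ.send f alice bob).state) (decode (σ'.send f alice bob).state) ∧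
      (σ.Settled p → (decode (σ.send f alice bob).state).Settled p) ∧
      (σ.send f alice bob).qnt = (σ'.send f alice bob).qnt ∧
      (σ.send f alice bob).cls = (σ'.send f alice bob).cls ∧
      ((σ.send f alice bob).cls = [] ∨
        (∃ i, (σ.send f alice bob).cls = triple f i [false]) ∧
          (decode (σ.send f alice bob).state).Settled p) := by
  rcases σ with ⟨x, y, u, v⟩
  rcases σ' with ⟨x', y', u', v'⟩
  obtain ⟨h₁, h₂, h₃, h₄⟩ := h
  dsimp only at h₂ h₃
  subst h₂ h₃
  cases p <;> simp only [AndState.own, AndState.other, if_true, Bool.false_eq_true, if_false]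
    at h₁ h₄ <;> subst h₁ <;> rcases h₄ with ⟨rfl, rfl⟩ | ⟨rfl, rfl, h₄⟩
  · rcases x with _ | x <;>
      simp [AndState.send, decode_encode, coupled_iff, Settled, AndState.own, AndState.other]
  · rcases x with _ | _ | _ <;> cases u <;> cases v <;>
      simp [AndState.send, decode_encode, coupled_iff, Settled, AndState.own, AndState.other,
        triple_inj] at h₄ ⊢
  · rcases y with _ | y <;>
      simp [AndState.send, decode_encode, coupled_iff, Settled, AndState.own, AndState.other]
  · rcases y with _ | _ | _ <;> cases u <;> cases v <;>
      simp [AndState.send, decode_encode, coupled_iff, Settled, AndState.own, AndState.other,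
        triple_inj] at h₄ ⊢

/-- Recording a message in coupled states: if the honest party sends its input, it is `1` in the
first and `0` in the second state. -/
theorem Coupled.record (hab : alice ≠ bob) (h : Coupled p σ σ') {s m m' : Bits}
    (hm : m = m' ∧ (s = honestParty alice bob p → bitOf m = none) ∨
      s = honestParty alice bob p ∧ m = [true] ∧ m' = [false]) :
    Coupled p (σ.record alice bob s m) (σ'.record alice bob s m') ∧
        (σ.Settled p → (σ.record alice bob s m).Settled p) ∨
      ¬ σ.Settled p ∧ (σ.record alice bob s m).Dead := by
  rcases σ with ⟨x, y, u, v⟩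
  rcases σ' with ⟨x', y', u', v'⟩
  obtain ⟨h₁, h₂, h₃, h₄⟩ := h
  dsimp only at h₂ h₃
  subst h₂ h₃
  by_cases hs : s = honestParty alice bob p
  · -- the honest party
    have hm' : bitOf m = none ∧ bitOf m' = none ∨ bitOf m = some true ∧ bitOf m' = some false := by
      rcases hm with ⟨rfl, hm⟩ | ⟨-, rfl, rfl⟩
      · exact Or.inl ⟨hm hs, hm hs⟩
      · exact Or.inr ⟨rfl, rfl⟩
    subst hs
    clear hm
    cases p <;> simp only [AndState.own, AndState.other, if_true, Bool.false_eq_true, if_false]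
      at h₁ h₄ <;> subst h₁ <;> rcases h₄ with ⟨rfl, rfl⟩ | ⟨rfl, rfl, h₄⟩
    · rcases x with _ | _ | _ <;> rcases hm' with ⟨h, h'⟩ | ⟨h, h'⟩ <;>
        simp [AndState.record, honestParty, hab.symm, coupled_iff, Settled, Dead, AndState.own,
          AndState.other, h, h']
    · rcases x with _ | _ | _ <;>
        simp [AndState.record, honestParty, hab.symm, coupled_iff, Settled, Dead, AndState.own,
          AndState.other] at h₄ ⊢
    · rcases y with _ | _ | _ <;> rcases hm' with ⟨h, h'⟩ | ⟨h, h'⟩ <;>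
        simp [AndState.record, honestParty, coupled_iff, Settled, Dead, AndState.own,
          AndState.other, h, h']
    · rcases y with _ | _ | _ <;>
        simp [AndState.record, honestParty, coupled_iff, Settled, Dead, AndState.own,
          AndState.other] at h₄ ⊢
  · obtain rfl : m = m' := by
      rcases hm with ⟨hm, -⟩ | ⟨hm, -⟩
      exacts [hm, absurd hm hs]
    clear hm
    cases p <;> simp only [AndState.own, AndState.other, if_true, Bool.false_eq_true, if_false,
      honestParty] at h₁ h₄ hs <;> subst h₁ <;> rcases h₄ with ⟨rfl, rfl⟩ | ⟨rfl, rfl, h₄⟩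
    · by_cases hs' : s = alice <;>
        simp [AndState.record, hs, hs', coupled_iff, Settled, Dead, AndState.own,
          AndState.other]
    · by_cases hs' : s = alice <;> rcases x with _ | _ | _ <;>
        rcases hb : bitOf m with _ | _ | _ <;>
        simp [AndState.record, hs, hs', hb, coupled_iff, Settled, Dead, AndState.own,
          AndState.other] at h₄ ⊢
    · by_cases hs' : s = bob <;>
        simp [AndState.record, hs, hs', hab.symm, coupled_iff, Settled, Dead, AndState.own,
          AndState.other]
    · by_cases hs' : s = bob <;> rcases y with _ | _ | _ <;> rcases hb : bitOf m with _ | _ | _ <;>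
        simp [AndState.record, hs, hs', hb, hab.symm, coupled_iff, Settled, Dead, AndState.own,
          AndState.other] at h₄ ⊢

end AndState

/-- The functionality stays dead, and sends no other result than `1`. -/
theorem andStep_dead {alice bob f : Identity} {s c q : Bits} (h : (AndState.decode s).Dead) :
    (AndState.decode (andStep f alice bob ⟨s, c, q⟩).state).Dead ∧
      ((andStep f alice bob ⟨s, c, q⟩).cls = [] ∨
        ∃ i, (andStep f alice bob ⟨s, c, q⟩).cls = triple f i [true]) := by
  unfold andStep
  rcases parse c with _ | ⟨sender, j, m⟩
  · exact ⟨h, Or.inl rfl⟩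
  dsimp only
  split_ifs
  · exact h.record.send
  · exact ⟨h, Or.inl rfl⟩

/-- Two runs of the functionality whose states are coupled behave alike until both inputs are `1` in
the first of them. -/
theorem andStep_coupled {alice bob f : Identity} (hab : alice ≠ bob) {p : Bool}
    {s s' sender j m m' q : Bits} (h : AndState.Coupled p (AndState.decode s) (AndState.decode s'))
    (hm : m = m' ∧ (sender = AndState.honestParty alice bob p → bitOf m = none) ∨
      sender = AndState.honestParty alice bob p ∧ m = [true] ∧ m' = [false])
    {r r' : Regs} (hr : andStep f alice bob ⟨s, triple sender j m, q⟩ = r)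
    (hr' : andStep f alice bob ⟨s', triple sender j m', q⟩ = r') :
    (AndState.Coupled p (AndState.decode r.state) (AndState.decode r'.state) ∧
      ((AndState.decode s).Settled p → (AndState.decode r.state).Settled p) ∧
      r.qnt = r'.qnt ∧ r.cls = r'.cls ∧
      (r.cls = [] ∨ (∃ i, r.cls = triple f i [false]) ∧ (AndState.decode r.state).Settled p)) ∨
    (¬ (AndState.decode s).Settled p ∧ (AndState.decode r.state).Dead ∧
      (r.cls = [] ∨ ∃ i, r.cls = triple f i [true])) := by
  subst hr hr'
  simp only [andStep, parse_triple]
  split_ifs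
  · rcases h.record hab hm with ⟨hc, hs⟩ | ⟨hs, hd⟩
    · obtain ⟨h₁, h₂, h₃⟩ := hc.send (alice := alice) (bob := bob) (f := f)
      exact Or.inl ⟨h₁, fun h => h₂ (hs h), h₃⟩
    · exact Or.inr ⟨hs, hd.send⟩
  · exact Or.inl ⟨h, id, rfl, rfl, Or.inl rfl⟩

/-! ### The ideal network does not reveal the honest input -/

section

open AndState

/-- What the environment may do in one step, if it notifies the adversary. -/
theorem environmentStep_cases (alice bob : Identity) (r : Regs) :
    (r.state.length = 0 ∧ ∀ a b, environmentStep alice bob a b true r =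
      ⟨[true], triple environment alice [a], []⟩) ∨
    (∃ y, r.state.length = 2 * y + 1 ∧ r.cls = expected alice bob y ∧ ∀ a b,
      environmentStep alice bob a b true r =
        ⟨List.replicate (2 * y + 2) true, triple environment adversary [], []⟩) ∨
    (∀ a b, environmentStep alice bob a b true r = Regs.reject) ∨
    (r.state.length = 6 ∧ ∀ a b, environmentStep alice bob a b true r =
      ⟨[], triple environment [] [true], []⟩) ∨
    ∃ y, r.state.length = 2 * y + 2 ∧ ∀ a b, environmentStep alice bob a b true r =
      ⟨List.replicate (2 * y + 3) true, nextMsg bob b y, []⟩ := by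
  by_cases h₀ : r.state.length = 0
  · exact Or.inl ⟨h₀, fun a b => by simp [environmentStep, h₀]⟩
  right
  rcases Nat.even_or_odd' r.state.length with ⟨y, hy | hy⟩
  · right
    obtain ⟨y, rfl⟩ : ∃ y', y = y' + 1 := Nat.exists_eq_succ_of_ne_zero (by omega)
    have h₁ : ¬ r.state.length % 2 = 1 := by omega
    have h₂ : r.state.length / 2 - 1 = y := by omega
    by_cases hy2 : y = 2
    · subst hy2
      by_cases hc : r.cls = triple adversary environment [true]
      · right; left
        exact ⟨hy, fun a b => by
          simp only [environmentStep, if_neg h₀, if_neg h₁, h₂]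
          simp [hc, Regs.proceed]⟩
      · left
        intro a b
        simp only [environmentStep, if_neg h₀, if_neg h₁, h₂]
        simp [hc]
    · right; right
      refine ⟨y, hy, fun a b => ?_⟩
      simp only [environmentStep, if_neg h₀, if_neg h₁, h₂]
      simp [hy2, Regs.proceed, Nat.mul_add]
  · have h₁ : r.state.length % 2 = 1 := by omega
    have h₂ : r.state.length / 2 = y := by omega
    by_cases hc : r.cls = expected alice bob y
    · left
      refine ⟨y, hy, hc, fun a b => ?_⟩
      simp only [environmentStep, if_neg h₀, if_pos h₁, h₂, if_pos hc, if_true]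
      rw [hy]
    · right; left
      intro a b
      simp only [environmentStep, if_neg h₀, if_pos h₁, h₂, if_neg hc]

/-- Two ideal networks whose only difference is that the honest party is given the input `1` in `N`
and the input `0` in `N'`. The honest party is Alice if `p`, and Bob otherwise. -/
structure CoupledNetworks (alice bob f : Identity) (p x : Bool) (N N' : Network) : Prop where
  alice_ne_bob : alice ≠ bob
  alice_ne_nil : alice ≠ []
  bob_ne_nil : bob ≠ []
  functionality_ne : f ≠ environment
  honest_ne : honestParty alice bob p ≠ environment
  honest_ne_functionality : honestParty alice bob p ≠ f
  env : N environment =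
    some (testEnvironment alice bob (if p then true else x) (if p then x else true) true)
  env' : N' environment =
    some (testEnvironment alice bob (if p then false else x) (if p then x else false) true)
  functionality : N f = some (andFunctionality f alice bob)
  honest : N (honestParty alice bob p) = some (dummyParty f (honestParty alice bob p))
  congr : ∀ i, i ≠ environment → N' i = N i

/-- The length of the state of the environment after it got the result of the honest party. -/
def gate (p : Bool) : ℕ := if p then 4 else 6

/-- Both inputs are `1`, and the environment did not get a result of the honest party so far. -/
structure DeadConfig (alice bob f : Identity) (p : Bool) (σ : Config) : Prop where
  dead : (decode (σ.state f)).Dead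
  phase : (σ.state environment).length < gate p
  result : ∀ m, σ.cls = triple f (honestParty alice bob p) m ∨
    σ.cls = triple (honestParty alice bob p) environment m → m ≠ [false]

/-- The relation between the global states of coupled networks. They agree up to the input of the
honest party, which may be in the classical register. The honest party gets and reports a result
only if the inputs are settled. -/
structure CoupledConfig (alice bob f : Identity) (p : Bool) (σ σ' : Config) : Prop where
  qnt : σ.qnt = σ'.qnt
  state : ∀ i, i ≠ f → σ.state i = σ'.state i
  functionality : Coupled p (decode (σ.state f)) (decode (σ'.state f))
  phase : gate p ≤ (σ.state environment).length → (decode (σ.state f)).Settled p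
  cls : (σ.cls = σ'.cls ∧
      (∀ m, σ.cls = triple environment (honestParty alice bob p) m ∨
        σ.cls = triple (honestParty alice bob p) f m → bitOf m = none) ∧
      ∀ m, σ.cls = triple f (honestParty alice bob p) m ∨
        σ.cls = triple (honestParty alice bob p) environment m →
          (decode (σ.state f)).Settled p) ∨
    (σ.cls = triple environment (honestParty alice bob p) [true] ∧
      σ'.cls = triple environment (honestParty alice bob p) [false]) ∨
    (σ.cls = triple (honestParty alice bob p) f [true] ∧
      σ'.cls = triple (honestParty alice bob p) f [false])

theorem gate_cases (p : Bool) : gate p = 4 ∧ p = true ∨ gate p = 6 ∧ p = false := by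
  cases p <;> simp [gate]

namespace CoupledNetworks

variable {alice bob f : Identity} {p x : Bool} {N N' : Network} {k : ℕ} {σ σ' : Config}

theorem honest_ne_nil (hN : CoupledNetworks alice bob f p x N N') :
    honestParty alice bob p ≠ [] := by
  cases p
  exacts [hN.bob_ne_nil, hN.alice_ne_nil]

/-- The environment does not pass the gate unless it gets the result `0` from the honest party. -/
theorem cls_of_gate {y : ℕ} {c : Bits} (hc : c = expected alice bob y)
    (hy : 2 * y + 1 < gate p) (hy' : gate p ≤ 2 * y + 2) :
    c = triple (honestParty alice bob p) environment [false] := by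
  rcases gate_cases p with ⟨hg, rfl⟩ | ⟨hg, rfl⟩
  · obtain rfl : y = 1 := by omega
    exact hc
  · obtain rfl : y = 2 := by omega
    exact hc

theorem deadConfig_reset (hN : CoupledNetworks alice bob f p x N N') {st : Identity → Bits}
    (h₁ : (decode (st f)).Dead) (h₂ : (st environment).length < gate p) :
    DeadConfig alice bob f p (Config.reset st) where
  dead := h₁
  phase := h₂
  result m hm := by
    simp only [Config.reset, triple_inj] at hm
    rcases hm with ⟨-, h, -⟩ | ⟨-, -, rfl⟩
    · exact absurd h.symm hN.honest_ne
    · simp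

/-- A dead run is not accepted. -/
theorem accept_eq_zero (hN : CoupledNetworks alice bob f p x N N') (n : ℕ)
    (hσ : DeadConfig alice bob f p σ) : N.accept k n σ = 0 := by
  induction n generalizing σ with
  | zero => exact Network.accept_zero
  | succ n ih =>
    have hreset := hN.deadConfig_reset hσ.dead hσ.phase
    rcases hp : parse σ.cls with _ | ⟨s, i, m⟩
    · rw [Network.accept_succ_parse_none hp]
      exact ih hreset
    have hcls := triple_of_parse _ _ _ _ hp
    by_cases hie : i = environment
    · subst hie
      rw [Network.accept_succ_det hp hN.env]
      rcases environmentStep_cases alice bob ⟨σ.state environment, σ.cls, σ.qnt⟩ with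
        ⟨-, h⟩ | ⟨y, hy, hc, h⟩ | h | ⟨hl, -⟩ | ⟨y, hy, h⟩
      · rw [h, Config.afterRun_eq, Config.dispatch_triple, Network.acceptNow_of_none
          (by rw [Config.output_triple]; simp [hN.alice_ne_nil])]
        refine ih ⟨?_, ?_, ?_⟩
        · dsimp only
          rw [Function.update_of_ne hN.functionality_ne]
          exact hσ.dead
        · rcases gate_cases p with ⟨hg, -⟩ | ⟨hg, -⟩ <;> simp [hg]
        · intro m' hm
          simp only [triple_inj] at hm
          rcases hm with ⟨h, -⟩ | ⟨h, -⟩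
          exacts [absurd h.symm hN.functionality_ne, absurd h.symm hN.honest_ne]
      · rw [h, Config.afterRun_eq, Config.dispatch_triple, Network.acceptNow_of_none
          (by rw [Config.output_triple]; simp [adversary])]
        have hphase := hσ.phase
        dsimp only at hy hc
        refine ih ⟨?_, ?_, ?_⟩
        · dsimp only
          rw [Function.update_of_ne hN.functionality_ne]
          exact hσ.dead
        · simp only [Function.update_self, List.length_replicate]
          by_contra hg
          have := cls_of_gate (p := p) hc (by omega) (by omega)
          exact hσ.result [false] (Or.inr this) rfl
        · intro m' hm
          simp only [triple_inj] at hm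
          rcases hm with ⟨h, -⟩ | ⟨h, -⟩
          exacts [absurd h.symm hN.functionality_ne, absurd h.symm hN.honest_ne]
      · rw [h, Network.acceptNow, output_afterRun_reject]
        simp
      · have := hσ.phase
        dsimp only at hl
        rcases gate_cases p with ⟨hg, -⟩ | ⟨hg, -⟩ <;> omega
      · obtain ⟨m', hm'⟩ := nextMsg_eq (bob := bob) (b := if p then x else true) (y := y)
        rw [h, hm', Config.afterRun_eq, Config.dispatch_triple, Network.acceptNow_of_none
          (by rw [Config.output_triple]; simp [hN.bob_ne_nil])]
        have hphase := hσ.phase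
        dsimp only at hy
        refine ih ⟨?_, ?_, ?_⟩
        · dsimp only
          rw [Function.update_of_ne hN.functionality_ne]
          exact hσ.dead
        · simp only [Function.update_self, List.length_replicate]
          rcases gate_cases p with ⟨hg, -⟩ | ⟨hg, -⟩ <;> omega
        · intro m' hm
          simp only [triple_inj] at hm
          rcases hm with ⟨h, -⟩ | ⟨h, -⟩
          exacts [absurd h.symm hN.functionality_ne, absurd h.symm hN.honest_ne]
    by_cases hif : i = f
    · subst hif
      rw [Network.accept_succ_det hp hN.functionality, Config.afterRun_eq,
        Network.acceptNow_of_none (Config.output_dispatch hN.functionality_ne _ _ _)]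
      obtain ⟨hd, hc⟩ := andStep_dead (alice := alice) (bob := bob) (f := i) (c := σ.cls)
        (q := σ.qnt) hσ.dead
      set r := andStep i alice bob ⟨σ.state i, σ.cls, σ.qnt⟩
      have h₁ : (decode (Function.update σ.state i r.state i)).Dead := by simpa using hd
      have h₂ : (Function.update σ.state i r.state environment).length < gate p := by
        rw [Function.update_of_ne hN.functionality_ne.symm]
        exact hσ.phase
      rcases hc with hc | ⟨j, hc⟩
      · rw [hc, Config.dispatch_nil]
        exact ih (hN.deadConfig_reset h₁ h₂)
      · rw [hc, Config.dispatch_triple]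
        refine ih ⟨h₁, h₂, ?_⟩
        intro m' hm
        simp only [triple_inj] at hm
        rcases hm with ⟨-, -, rfl⟩ | ⟨h, -⟩
        exacts [by simp, absurd h.symm hN.honest_ne_functionality]
    by_cases hiP : i = honestParty alice bob p
    · subst hiP
      by_cases hse : s = environment
      · subst hse
        rw [show σ = ⟨triple environment (honestParty alice bob p) m, σ.qnt, σ.state⟩
          from by rw [← hcls], leads_dummyParty_of_environment hN.honest hN.honest_ne n]
        refine ih ⟨hσ.dead, hσ.phase, ?_⟩
        intro m' hm
        simp only [triple_inj] at hm
        rcases hm with ⟨h, -⟩ | ⟨-, h, -⟩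
        exacts [absurd h hN.honest_ne_functionality, absurd h hN.functionality_ne]
      by_cases hsf : s = f
      · subst hsf
        rw [show σ = ⟨triple s (honestParty alice bob p) m, σ.qnt, σ.state⟩
          from by rw [← hcls], leads_dummyParty_of_functionality hN.honest hN.honest_ne
            hN.functionality_ne n]
        refine ih ⟨hσ.dead, hσ.phase, ?_⟩
        intro m' hm
        simp only [triple_inj] at hm
        rcases hm with ⟨h, -⟩ | ⟨-, -, rfl⟩
        exacts [absurd h hN.honest_ne_functionality, hσ.result m (Or.inl hcls)]
      · rw [Network.accept_succ_det hp hN.honest, Config.afterRun_eq,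
          Network.acceptNow_of_none (Config.output_dispatch hN.honest_ne _ _ _)]
        simp only [hp, hse, hsf, if_false, Function.update_eq_self]
        rcases Config.dispatch_cases (honestParty alice bob p) σ.state σ.cls σ.qnt with
          ⟨j, m, -, h⟩ | ⟨-, h⟩
        · rw [h]
          exact ih hσ
        · rw [h]
          exact ih hreset
    rcases hi : N i with _ | M
    · rw [Network.accept_succ_none hp hi]
      exact ih hreset
    · rw [Network.accept_succ_machine (g := id) hp hi (PMF.map_id _).symm,
        ENNReal.tsum_eq_zero]
      intro r
      rw [mul_eq_zero]
      right
      rw [Config.afterRun_eq, Network.acceptNow_of_none (Config.output_dispatch hie _ _ _)]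
      have h₁ : (decode (Function.update σ.state i (id r).state f)).Dead := by
        rw [Function.update_of_ne (Ne.symm hif)]
        exact hσ.dead
      have h₂ : (Function.update σ.state i (id r).state environment).length <
          gate p := by
        rw [Function.update_of_ne (Ne.symm hie)]
        exact hσ.phase
      rcases Config.dispatch_cases i (Function.update σ.state i (id r).state) (id r).cls
        (id r).qnt with ⟨j, m, hj, h⟩ | ⟨-, h⟩
      · rw [h]
        refine ih ⟨h₁, h₂, ?_⟩
        intro m' hm
        simp only [hj, triple_inj] at hm
        rcases hm with ⟨h, -⟩ | ⟨h, -⟩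
        exacts [absurd h hif, absurd h hiP]
      · rw [h]
        exact ih (hN.deadConfig_reset h₁ h₂)

end CoupledNetworks

end

section

open AndState

namespace CoupledNetworks

variable {alice bob f : Identity} {p x : Bool} {N N' : Network} {k : ℕ} {σ σ' : Config}

/-- Related local states of coupled networks. -/
structure CoupledStates (f : Identity) (p : Bool) (st st' : Identity → Bits) : Prop where
  state : ∀ i, i ≠ f → st i = st' i
  functionality : Coupled p (decode (st f)) (decode (st' f))
  phase : gate p ≤ (st environment).length → (decode (st f)).Settled p

theorem _root_.ClassicalUC.CoupledConfig.coupledStates (h : CoupledConfig alice bob f p σ σ') :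
    CoupledStates f p σ.state σ'.state := ⟨h.state, h.functionality, h.phase⟩

theorem CoupledStates.update {st st' : Identity → Bits} (h : CoupledStates f p st st')
    {i : Identity} (hf : i ≠ f) (he : i ≠ environment) (s : Bits) :
    CoupledStates f p (Function.update st i s) (Function.update st' i s) where
  state j hj := by
    rcases eq_or_ne j i with rfl | hji
    · simp
    · simp [hji, h.state j hj]
  functionality := by
    rw [Function.update_of_ne hf.symm, Function.update_of_ne hf.symm]
    exact h.functionality
  phase := by
    rw [Function.update_of_ne hf.symm, Function.update_of_ne he.symm]
    exact h.phase

theorem CoupledStates.update_environment {st st' : Identity → Bits}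
    (h : CoupledStates f p st st') (hf : f ≠ environment) (s : Bits)
    (hs : gate p ≤ s.length → (decode (st f)).Settled p) :
    CoupledStates f p (Function.update st environment s) (Function.update st' environment s) where
  state j hj := by
    rcases eq_or_ne j environment with rfl | hji
    · simp
    · simp [hji, h.state j hj]
  functionality := by
    rw [Function.update_of_ne hf, Function.update_of_ne hf]
    exact h.functionality
  phase := by
    rw [Function.update_of_ne hf, Function.update_self]
    exact hs

/-- A message that concerns neither the honest party's input nor its result. -/
theorem CoupledStates.config_of_ne {st st' : Identity → Bits} (h : CoupledStates f p st st')
    {s i m q : Bits} (h₁ : s ≠ f) (h₂ : s ≠ honestParty alice bob p)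
    (h₃ : s = environment → i = honestParty alice bob p → bitOf m = none) :
    CoupledConfig alice bob f p ⟨triple s i m, q, st⟩ ⟨triple s i m, q, st'⟩ where
  qnt := rfl
  state := h.state
  functionality := h.functionality
  phase := h.phase
  cls := by
    refine Or.inl ⟨rfl, fun m' hm => ?_, fun m' hm => ?_⟩
    · simp only [triple_inj] at hm
      rcases hm with ⟨hs, hi, rfl⟩ | ⟨h, -⟩
      exacts [h₃ hs hi, absurd h h₂]
    · simp only [triple_inj] at hm
      rcases hm with ⟨h, -⟩ | ⟨h, -⟩
      exacts [absurd h h₁, absurd h h₂]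

theorem coupledConfig_reset (hN : CoupledNetworks alice bob f p x N N') {st st' : Identity → Bits}
    (h : CoupledStates f p st st') :
    CoupledConfig alice bob f p (Config.reset st) (Config.reset st') where
  qnt := rfl
  state := h.state
  functionality := h.functionality
  phase := h.phase
  cls := by
    refine Or.inl ⟨rfl, fun m' hm => ?_, fun m' hm => ?_⟩
    · simp only [Config.reset, triple_inj] at hm
      rcases hm with ⟨h, -⟩ | ⟨-, h, -⟩
      exacts [absurd h (by simp [environment]), absurd h.symm hN.functionality_ne]
    · simp only [Config.reset, triple_inj] at hm
      rcases hm with ⟨-, h, -⟩ | ⟨h, -⟩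
      exacts [absurd h.symm hN.honest_ne, absurd h.symm hN.honest_ne_nil]

/-- The functionality runs in coupled networks. -/
theorem accept_functionality_le (hN : CoupledNetworks alice bob f p x N N') {n : ℕ}
    (ih : ∀ {σ σ'}, CoupledConfig alice bob f p σ σ' → N.accept k n σ ≤ N'.accept k n σ')
    (hσ : CoupledConfig alice bob f p σ σ') {s m m' : Bits}
    (hc : σ.cls = triple s f m) (hc' : σ'.cls = triple s f m')
    (hm : m = m' ∧ (s = honestParty alice bob p → bitOf m = none) ∨
      s = honestParty alice bob p ∧ m = [true] ∧ m' = [false]) :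
    N.accept k (n + 1) σ ≤ N'.accept k (n + 1) σ' := by
  have hN' : N' f = some (andFunctionality f alice bob) := by
    rw [hN.congr f hN.functionality_ne, hN.functionality]
  rw [Network.accept_succ_det (by rw [hc, parse_triple]) hN.functionality,
    Network.accept_succ_det (by rw [hc', parse_triple]) hN', Config.afterRun_eq,
    Config.afterRun_eq,
    Network.acceptNow_of_none (Config.output_dispatch hN.functionality_ne _ _ _),
    Network.acceptNow_of_none (Config.output_dispatch hN.functionality_ne _ _ _), hc, hc', ← hσ.qnt]
  generalize hr : andStep f alice bob ⟨σ.state f, triple s f m, σ.qnt⟩ = r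
  generalize hr' : andStep f alice bob ⟨σ'.state f, triple s f m', σ.qnt⟩ = r'
  rcases andStep_coupled hN.alice_ne_bob hσ.functionality hm hr hr' with
    ⟨h₁, h₂, h₃, h₄, h₅⟩ | ⟨h₁, h₂, h₃⟩
  · have hst : CoupledStates f p (Function.update σ.state f r.state)
        (Function.update σ'.state f r'.state) :=
      { state := fun i hi => by simp [hi, hσ.state i hi]
        functionality := by simpa using h₁
        phase := by
          rw [Function.update_of_ne hN.functionality_ne.symm, Function.update_self]
          exact fun h => h₂ (hσ.phase h) }
    rw [← h₃, ← h₄]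
    rcases h₅ with h₅ | ⟨⟨i, h₅⟩, h₆⟩
    · rw [h₅, Config.dispatch_nil, Config.dispatch_nil]
      exact ih (hN.coupledConfig_reset hst)
    · rw [h₅, Config.dispatch_triple, Config.dispatch_triple]
      refine ih ⟨rfl, hst.state, hst.functionality, hst.phase, Or.inl ⟨rfl, fun m hm => ?_,
        fun m hm => by simpa using h₆⟩⟩
      simp only [triple_inj] at hm
      rcases hm with ⟨h, -⟩ | ⟨h, -⟩
      exacts [absurd h hN.functionality_ne, absurd h.symm hN.honest_ne_functionality]
  · have hd : (decode (Function.update σ.state f r.state f)).Dead := by simpa using h₂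
    have hphase : (Function.update σ.state f r.state environment).length < gate p := by
      rw [Function.update_of_ne hN.functionality_ne.symm]
      by_contra h
      exact h₁ (hσ.phase (by omega))
    refine le_of_eq_of_le (hN.accept_eq_zero n ?_) zero_le
    rcases h₃ with h₃ | ⟨i, h₃⟩
    · rw [h₃, Config.dispatch_nil]
      exact hN.deadConfig_reset hd hphase
    · rw [h₃, Config.dispatch_triple]
      refine ⟨hd, hphase, fun m hm => ?_⟩
      simp only [triple_inj] at hm
      rcases hm with ⟨-, -, rfl⟩ | ⟨h, -⟩
      exacts [by simp, absurd h.symm hN.honest_ne_functionality]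

/-- The environment runs in coupled networks. -/
theorem accept_environment_le (hN : CoupledNetworks alice bob f p x N N') {n : ℕ}
    (ih : ∀ {σ σ'}, CoupledConfig alice bob f p σ σ' → N.accept k n σ ≤ N'.accept k n σ')
    (hσ : CoupledConfig alice bob f p σ σ') {s m : Bits}
    (hc : σ.cls = triple s environment m) (hc' : σ.cls = σ'.cls)
    (hset : ∀ m, σ.cls = triple (honestParty alice bob p) environment m →
      (decode (σ.state f)).Settled p) :
    N.accept k (n + 1) σ ≤ N'.accept k (n + 1) σ' := by
  have hst := hσ.coupledStates
  have hfe := hN.functionality_ne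
  rw [Network.accept_succ_det (by rw [hc, parse_triple]) hN.env,
    Network.accept_succ_det (by rw [← hc', hc, parse_triple]) hN.env',
    ← hσ.qnt, ← hc', ← hσ.state environment hfe.symm]
  rcases environmentStep_cases alice bob ⟨σ.state environment, σ.cls, σ.qnt⟩ with
    ⟨-, h⟩ | ⟨y, hy, hyc, h⟩ | h | ⟨-, h⟩ | ⟨y, hy, h⟩
  · rw [h, h, Config.afterRun_eq, Config.dispatch_triple, Config.afterRun_eq,
      Config.dispatch_triple, Network.acceptNow_of_none
        (by rw [Config.output_triple]; simp [hN.alice_ne_nil]), Network.acceptNow_of_none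
        (by rw [Config.output_triple]; simp [hN.alice_ne_nil])]
    have hst' := hst.update_environment hfe [true] (fun hg => by
      rcases gate_cases p with ⟨hg', -⟩ | ⟨hg', -⟩ <;> simp [hg'] at hg)
    rcases p with _ | _
    · exact ih (hst'.config_of_ne hfe.symm hN.honest_ne.symm
        fun _ h => absurd h hN.alice_ne_bob)
    · exact ih ⟨rfl, hst'.state, hst'.functionality, hst'.phase, Or.inr (Or.inl ⟨rfl, rfl⟩)⟩
  · rw [h, h, Config.afterRun_eq, Config.dispatch_triple, Config.afterRun_eq,
      Config.dispatch_triple, Network.acceptNow_of_none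
        (by rw [Config.output_triple]; simp [adversary]), Network.acceptNow_of_none
        (by rw [Config.output_triple]; simp [adversary])]
    dsimp only at hy hyc
    refine ih ((hst.update_environment hfe _ fun hg => ?_).config_of_ne hfe.symm
      hN.honest_ne.symm fun _ _ => rfl)
    simp only [List.length_replicate] at hg
    by_cases hg' : gate p ≤ 2 * y + 1
    · exact hσ.phase (by omega)
    · exact hset [false] (cls_of_gate hyc (by omega) (by omega))
  · rw [h, h, Network.acceptNow, output_afterRun_reject]
    simp
  · rw [h, h, Network.acceptNow, Network.acceptNow, Config.afterRun_eq, Config.dispatch_triple,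
      Config.afterRun_eq, Config.dispatch_triple, Config.output_triple, Config.output_triple]
    simp
  · dsimp only at hy
    have hst' := hst.update_environment hfe (List.replicate (2 * y + 3) true) (fun hg => by
      refine hσ.phase ?_
      simp only [List.length_replicate] at hg
      rcases gate_cases p with ⟨hg', -⟩ | ⟨hg', -⟩ <;> omega)
    rw [h, h]
    rcases y with _ | y
    · simp only [nextMsg]
      rw [Config.afterRun_eq, Config.dispatch_triple, Config.afterRun_eq,
        Config.dispatch_triple, Network.acceptNow_of_none
          (by rw [Config.output_triple]; simp [hN.bob_ne_nil]), Network.acceptNow_of_none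
          (by rw [Config.output_triple]; simp [hN.bob_ne_nil])]
      rcases p with _ | _
      · exact ih ⟨rfl, hst'.state, hst'.functionality, hst'.phase, Or.inr (Or.inl ⟨rfl, rfl⟩)⟩
      · exact ih (hst'.config_of_ne hfe.symm hN.honest_ne.symm
          fun _ h => absurd h.symm hN.alice_ne_bob)
    · simp only [nextMsg]
      rw [Config.afterRun_eq, Config.dispatch_triple, Config.afterRun_eq,
        Config.dispatch_triple, Network.acceptNow_of_none
          (by rw [Config.output_triple]; simp [hN.bob_ne_nil]), Network.acceptNow_of_none
          (by rw [Config.output_triple]; simp [hN.bob_ne_nil])]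
      exact ih (hst'.config_of_ne hfe.symm hN.honest_ne.symm fun _ _ => rfl)

/-- Changing the honest input from `1` to `0` does not make acceptance less likely: the runs agree
until the other input turns out to be `1`, and then the first one is not accepted, because the
honest party can only report the result `1`. -/
theorem accept_le (hN : CoupledNetworks alice bob f p x N N') (n : ℕ)
    (hσ : CoupledConfig alice bob f p σ σ') : N.accept k n σ ≤ N'.accept k n σ' := by
  induction n generalizing σ σ' with
  | zero => rw [Network.accept_zero]; exact zero_le
  | succ n ih =>
    have hst := hσ.coupledStates
    have hP' : N' (honestParty alice bob p) = some (dummyParty f (honestParty alice bob p)) := by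
      rw [hN.congr _ hN.honest_ne, hN.honest]
    have hreset := ih (hN.coupledConfig_reset hst)
    rcases hσ.cls with ⟨hc, hin, hset⟩ | ⟨hc, hc'⟩ | ⟨hc, hc'⟩
    · rcases hp : parse σ.cls with _ | ⟨s, i, m⟩
      · rw [Network.accept_succ_parse_none hp, Network.accept_succ_parse_none (hc ▸ hp)]
        exact hreset
      have hcls := triple_of_parse _ _ _ _ hp
      have hp' : parse σ'.cls = some (s, i, m) := hc ▸ hp
      by_cases hie : i = environment
      · subst hie
        exact hN.accept_environment_le ih hσ hcls hc fun m hm => hset m (Or.inr hm)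
      by_cases hif : i = f
      · subst hif
        refine hN.accept_functionality_le ih hσ hcls (hc ▸ hcls) (Or.inl ⟨rfl, ?_⟩)
        rintro rfl
        exact hin m (Or.inr hcls)
      by_cases hiP : i = honestParty alice bob p
      · subst hiP
        have hσeq : σ = ⟨triple s (honestParty alice bob p) m, σ.qnt, σ.state⟩ := by rw [← hcls]
        have hσeq' : σ' = ⟨triple s (honestParty alice bob p) m, σ'.qnt, σ'.state⟩ := by
          rw [← hcls, hc]
        by_cases hse : s = environment
        · subst hse
          rw [hσeq, hσeq', leads_dummyParty_of_environment hN.honest hN.honest_ne n,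
            leads_dummyParty_of_environment hP' hN.honest_ne n]
          refine ih ⟨hσ.qnt, hst.state, hst.functionality, hst.phase,
            Or.inl ⟨rfl, fun m' hm => ?_, fun m' hm => ?_⟩⟩
          · simp only [triple_inj] at hm
            rcases hm with ⟨h, -⟩ | ⟨-, -, rfl⟩
            exacts [absurd h hN.honest_ne, hin m (Or.inl hcls)]
          · simp only [triple_inj] at hm
            rcases hm with ⟨h, -⟩ | ⟨-, h, -⟩
            exacts [absurd h hN.honest_ne_functionality, absurd h hN.functionality_ne]
        by_cases hsf : s = f
        · subst hsf
          rw [hσeq, hσeq', leads_dummyParty_of_functionality hN.honest hN.honest_ne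
            hN.functionality_ne n, leads_dummyParty_of_functionality hP' hN.honest_ne
            hN.functionality_ne n]
          refine ih ⟨hσ.qnt, hst.state, hst.functionality, hst.phase,
            Or.inl ⟨rfl, fun m' hm => ?_, fun m' hm => hset m (Or.inl hcls)⟩⟩
          simp only [triple_inj] at hm
          rcases hm with ⟨h, -⟩ | ⟨-, h, -⟩
          exacts [absurd h hN.honest_ne, absurd h.symm hN.functionality_ne]
        · rw [Network.accept_succ_det hp hN.honest, Network.accept_succ_det hp' hP',
            Config.afterRun_eq, Config.afterRun_eq,
            Network.acceptNow_of_none (Config.output_dispatch hN.honest_ne _ _ _),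
            Network.acceptNow_of_none (Config.output_dispatch hN.honest_ne _ _ _)]
          simp only [hp, hp', hse, hsf, if_false, Function.update_eq_self]
          rw [← hc]
          rcases Config.dispatch_cases (honestParty alice bob p) σ.state σ.cls σ.qnt with
            ⟨j, m', hj, h⟩ | ⟨hne, h⟩
          · rw [h]
            refine (ih hσ).trans_eq ?_
            rw [hj, Config.dispatch_triple, ← hj, hc]
          · rw [h]
            rcases Config.dispatch_cases (honestParty alice bob p) σ'.state σ.cls σ'.qnt with
              ⟨j, m', hj, -⟩ | ⟨-, h'⟩
            · exact absurd hj (hne j m')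
            · rw [h']
              exact hreset
      rcases hi : N i with _ | M
      · rw [Network.accept_succ_none hp hi,
          Network.accept_succ_none hp' (by rw [hN.congr i hie, hi])]
        exact hreset
      · rw [Network.accept_succ_machine (g := id) hp hi (PMF.map_id _).symm,
          Network.accept_succ_machine (g := id) hp' (by rw [hN.congr i hie, hi])
            (PMF.map_id _).symm, ← hσ.state i hif, ← hc, ← hσ.qnt]
        refine ENNReal.tsum_le_tsum fun r => mul_le_mul_right ?_ _
        rw [Config.afterRun_eq, Config.afterRun_eq,
          Network.acceptNow_of_none (Config.output_dispatch hie _ _ _),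
          Network.acceptNow_of_none (Config.output_dispatch hie _ _ _)]
        have hst' := hst.update hif hie (id r).state
        rcases parse_cases : parse (id r).cls with _ | ⟨s', j, m'⟩
        · simp only [Config.dispatch, parse_cases]
          exact ih (hN.coupledConfig_reset hst')
        · simp only [Config.dispatch, parse_cases]
          split_ifs with hs
          · rw [triple_of_parse _ _ _ _ parse_cases]
            refine ih (hst'.config_of_ne ?_ ?_ ?_)
            · rwa [hs]
            · rwa [hs]
            · rw [hs]
              exact fun h => absurd h hie
          · exact ih (hN.coupledConfig_reset hst')
    · have hσeq : σ = ⟨triple environment (honestParty alice bob p) [true], σ.qnt, σ.state⟩ := by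
        rw [← hc]
      have hσeq' : σ' = ⟨triple environment (honestParty alice bob p) [false], σ'.qnt,
          σ'.state⟩ := by rw [← hc']
      rw [hσeq, hσeq', leads_dummyParty_of_environment hN.honest hN.honest_ne n,
        leads_dummyParty_of_environment hP' hN.honest_ne n]
      exact ih ⟨hσ.qnt, hst.state, hst.functionality, hst.phase, Or.inr (Or.inr ⟨rfl, rfl⟩)⟩
    · exact hN.accept_functionality_le ih hσ hc hc' (Or.inr ⟨rfl, rfl, rfl⟩)

theorem iSup_accept_le (hN : CoupledNetworks alice bob f p x N N') :
    ⨆ n, N.accept k n (Config.init []) ≤ ⨆ n, N'.accept k n (Config.init []) := by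
  refine iSup_mono fun n => hN.accept_le n ?_
  have hst : CoupledStates f p (fun _ => []) (fun _ => []) :=
    { state := fun _ _ => rfl
      functionality := by cases p <;> simp [decode_nil, coupled_iff, AndState.own, AndState.other]
      phase := fun h => by
        rcases gate_cases p with ⟨hg', -⟩ | ⟨hg', -⟩ <;> simp [hg'] at h }
  exact hN.coupledConfig_reset hst

end CoupledNetworks

end

/-! ### The contradiction -/

open Filter

theorem Indistinguishable.eventually_le {N N' : Network} (h : Indistinguishable N N') {ε : ℝ}
    (hε : 0 < ε) :
    ∀ᶠ k in atTop, |N.exec k [] [true] - N'.exec k [] [true]| ≤ ε := by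
  obtain ⟨μ, hμ, h⟩ := h
  have := hμ 0
  simp only [pow_zero, one_mul] at this
  filter_upwards [this.eventually_le_const hε] with k hk
  exact (h [] k).trans hk

/-- The combinatorial core of the cut-and-paste argument: the common part of `q` and `r` is at most
the mean of `p` and `s` if `p * s = q * r`. -/
theorem two_mul_le_add_of_mul_eq {p q r s : ℝ≥0∞} (hp : p ≠ ∞) (hs : s ≠ ∞) (hr : r ≠ ∞)
    (h : p * s = q * r) (hqr : q ≤ r) : 2 * q ≤ p + s := by
  lift p to NNReal using hp
  lift s to NNReal using hs
  lift r to NNReal using hr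
  lift q to NNReal using ne_top_of_le_ne_top ENNReal.coe_ne_top hqr
  norm_cast at *
  rw [← NNReal.coe_le_coe] at *
  have h' : (p : ℝ) * s = q * r := by exact_mod_cast h
  push_cast
  have : (q : ℝ) * q ≤ p * s := by
    rw [h']
    exact mul_le_mul_of_nonneg_left hqr q.2
  nlinarith [sq_nonneg ((p : ℝ) - s), p.2, s.2, q.2, NNReal.coe_nonneg p, NNReal.coe_nonneg s]

/-- The mass of `w` on the set with indicator function `D`, and on its complement. -/
theorem tsum_ite_add_tsum_ite {ι : Type} (D : ι → Bool) (w : ι → ℝ≥0∞) :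
    (∑' t, (if D t then 1 else 0) * w t) + ∑' t, (if !D t then 1 else 0) * w t = ∑' t, w t := by
  rw [← ENNReal.tsum_add]
  refine tsum_congr fun t => ?_
  cases D t <;> simp

namespace HybridProtocol

variable {π : Protocol} (d : HybridProtocol π) (alice bob : Identity) (k : ℕ)

theorem tsum_runProb_le_one (a b : Bool) : ∑' t, d.runProb alice bob k a b t ≤ 1 := by
  have := TwoSided.iSup_value (d.system alice bob k) (fun _ => 1) (initial alice a b) []
  simp only [one_mul] at this
  refine this.symm.trans_le (iSup_le fun n => ?_)
  exact TwoSided.value_le_one fun _ => le_rfl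

theorem runProb_ne_top (a b : Bool) (t : List Event) : d.runProb alice bob k a b t ≠ ∞ :=
  ((ENNReal.le_tsum t).trans_lt ((d.tsum_runProb_le_one alice bob k a b).trans_lt
    ENNReal.one_lt_top)).ne

/-- The probability that the honest protocol has a transcript in `D`, and yields the results that
are expected for the product `0`. -/
noncomputable def mass (a b : Bool) (D : List Event → Bool) : ℝ :=
  (∑' t, (if D t then 1 else 0) * d.runProb alice bob k a b t).toReal

theorem tsum_ite_runProb_ne_top (a b : Bool) (D : List Event → Bool) :
    ∑' t, (if D t then 1 else 0) * d.runProb alice bob k a b t ≠ ∞ := by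
  refine ne_top_of_le_ne_top ENNReal.one_ne_top
    (le_trans ?_ (d.tsum_runProb_le_one alice bob k a b))
  gcongr with t
  cases D t <;> simp

theorem mass_add_mass_not (a b : Bool) (D : List Event → Bool) :
    d.mass alice bob k a b D + d.mass alice bob k a b (fun t => !D t) =
      d.mass alice bob k a b fun _ => true := by
  rw [mass, mass, ← ENNReal.toReal_add (d.tsum_ite_runProb_ne_top alice bob k a b D)
    (d.tsum_ite_runProb_ne_top alice bob k a b fun t => !D t), tsum_ite_add_tsum_ite, mass]
  simp

open Classical in
/-- The transcripts that are at most as likely on inputs `0` and `1` as on inputs `1` and `0`. -/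
noncomputable def splitSet (t : List Event) : Bool :=
  decide (d.runProb alice bob k false true t ≤ d.runProb alice bob k true false t)

theorem mass_splitSet_le :
    2 * (d.mass alice bob k false true (d.splitSet alice bob k) +
        d.mass alice bob k true false fun t => !d.splitSet alice bob k t) ≤
      d.mass alice bob k false false (fun _ => true) +
        d.mass alice bob k true true fun _ => true := by
  have hne := d.tsum_ite_runProb_ne_top alice bob k
  have key : 2 * (∑' t, (if d.splitSet alice bob k t then 1 else 0) *
        d.runProb alice bob k false true t +
      ∑' t, (if !d.splitSet alice bob k t then 1 else 0) * d.runProb alice bob k true false t) ≤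
      ∑' t, d.runProb alice bob k false false t + ∑' t, d.runProb alice bob k true true t := by
    rw [← ENNReal.tsum_add, ← ENNReal.tsum_add, ← ENNReal.tsum_mul_left]
    refine ENNReal.tsum_le_tsum fun t => ?_
    have hmul := d.runProb_mul alice bob k t
    by_cases ht : d.runProb alice bob k false true t ≤ d.runProb alice bob k true false t
    · have hD : d.splitSet alice bob k t = true := by simp [splitSet, ht]
      simpa [hD] using two_mul_le_add_of_mul_eq (d.runProb_ne_top _ _ _ _ _ _)
        (d.runProb_ne_top _ _ _ _ _ _) (d.runProb_ne_top _ _ _ _ _ _) hmul ht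
    · have hD : d.splitSet alice bob k t = false := by simp [splitSet, ht]
      simpa [hD] using two_mul_le_add_of_mul_eq (d.runProb_ne_top _ _ _ _ _ _)
        (d.runProb_ne_top _ _ _ _ _ _) (d.runProb_ne_top _ _ _ _ _ _)
        (hmul.trans (mul_comm _ _)) (le_of_not_ge ht)
  have hfin : ∀ a b, ∑' t, d.runProb alice bob k a b t ≠ ∞ := fun a b => by
    simpa using hne a b fun _ => true
  have := ENNReal.toReal_mono (ENNReal.add_ne_top.2 ⟨hfin _ _, hfin _ _⟩) key
  rw [ENNReal.toReal_mul,
    ENNReal.toReal_add (hne _ _ _) (hne _ _ fun t => !d.splitSet alice bob k t),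
    ENNReal.toReal_add (hfin _ _) (hfin _ _)] at this
  simpa [mass] using this

variable {d alice bob k}

theorem exec_realNetwork {a b : Bool} {κ : Option Bool} {D : ℕ → List Event → Bool}
    (halice : alice ∈ π.parties) (hbob : bob ∈ π.parties) (hab : alice ≠ bob) (ha : alice ≠ [])
    (hb : bob ≠ []) (hD : κ = none → D = fun _ _ => true) :
    (d.realNetwork alice bob a b κ D).exec k [] [true] = d.mass alice bob k a b (D k) := by
  rw [Network.exec_eq, iSup_accept_realNetwork halice hbob hab ha hb hD]
  rfl

variable {f : Identity} {hf : f ≠ environment ∧ f ≠ adversary}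

theorem corrupted_subset (κ : Option Bool) : corrupted alice π κ ⊆ π.parties := fun _ h => h.1

/-- Correctness of an emulating protocol: on all inputs, it yields the results that are expected for
the product `0` with almost the right probability. -/
theorem eventually_mass_univ (halice : alice ∈ π.parties) (hbob : bob ∈ π.parties)
    (hfp : f ∉ π.parties) (hab : alice ≠ bob) (ha : alice ≠ []) (hb : bob ≠ [])
    (h : π.EmulatesFunctionality f (andFunctionality f alice bob) hf) (d : HybridProtocol π)
    {ε : ℝ} (hε : 0 < ε) (a b : Bool) :
    ∀ᶠ k in atTop,
      |d.mass alice bob k a b (fun _ => true) - if a && b then 0 else 1| ≤ ε := by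
  obtain ⟨S, hS, -⟩ := h (corrupted alice π none) (corrupted_subset none)
    (d.emulator alice none fun _ _ => true)
  have hC : ∀ i, i ∉ corrupted alice π none := fun i hi => by simpa using hi.2
  have := hS (testEnvironment alice bob a b false)
  filter_upwards [this.eventually_le hε] with k hk
  have h₁ := exec_realNetwork (d := d) (k := k) (a := a) (b := b) (κ := none)
    (D := fun _ _ => true) halice hbob hab ha hb fun _ => rfl
  have h₂ := iSup_accept_idealNetwork (k := k) (a := a) (b := b) hf.1 ha hb hab
    (Protocol.ne_of_mem halice).1 (Protocol.ne_of_mem hbob).1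
    (idealNetwork_environment (hf := hf) (C := corrupted alice π none) (S := S))
    (idealNetwork_functionality (hC f)) (idealNetwork_honest halice (hC alice) hfp)
    (idealNetwork_honest hbob (hC bob) hfp)
  have h₃ : (idealNetwork π f alice bob hf (corrupted alice π none) S a b false).exec k [] [true] =
      if a && b then 0 else 1 := by
    rw [Network.exec_eq, h₂]
    split_ifs <;> simp
  rw [← h₁, ← h₃]
  exact hk

/-- Privacy of an emulating protocol: the corrupted side, which behaves honestly and has input `0`,
cannot tell the honest inputs `0` and `1` apart. The honest party is Alice if `p`, and Bob
otherwise. -/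
theorem eventually_mass_le (halice : alice ∈ π.parties) (hbob : bob ∈ π.parties)
    (hfp : f ∉ π.parties) (hab : alice ≠ bob) (ha : alice ≠ []) (hb : bob ≠ [])
    (h : π.EmulatesFunctionality f (andFunctionality f alice bob) hf) (d : HybridProtocol π)
    {ε : ℝ} (hε : 0 < ε) (p : Bool) (D : ℕ → List Event → Bool) :
    ∀ᶠ k in atTop,
      d.mass alice bob k p (!p) (D k) ≤ d.mass alice bob k false false (D k) + 2 * ε := by
  obtain ⟨S, hS, -⟩ := h (corrupted alice π (some (!p))) (corrupted_subset _)
    (d.emulator alice (some (!p)) D)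
  have hP : AndState.honestParty alice bob p ∈ π.parties := by
    cases p
    exacts [hbob, halice]
  have hPC : AndState.honestParty alice bob p ∉ corrupted alice π (some (!p)) := by
    rintro ⟨-, hi⟩
    cases p <;> simp [AndState.honestParty, ownSide, hab.symm] at hi
  have hfC : f ∉ corrupted alice π (some (!p)) := fun h => hfp h.1
  filter_upwards [(hS (testEnvironment alice bob p (!p) true)).eventually_le hε,
    (hS (testEnvironment alice bob false false true)).eventually_le hε] with k h₁ h₂
  have e₁ := exec_realNetwork (d := d) (k := k) (a := p) (b := !p) (κ := some (!p)) (D := D)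
    halice hbob hab ha hb (by simp)
  have e₂ := exec_realNetwork (d := d) (k := k) (a := false) (b := false) (κ := some (!p)) (D := D)
    halice hbob hab ha hb (by simp)
  have hN : CoupledNetworks alice bob f p false
      (idealNetwork π f alice bob hf (corrupted alice π (some (!p))) S p (!p) true)
      (idealNetwork π f alice bob hf (corrupted alice π (some (!p))) S false false true) :=
    { alice_ne_bob := hab
      alice_ne_nil := ha
      bob_ne_nil := hb
      functionality_ne := hf.1
      honest_ne := (Protocol.ne_of_mem hP).1
      honest_ne_functionality := fun h => hfp (h ▸ hP)
      env := by rw [idealNetwork_environment]; cases p <;> rfl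
      env' := by rw [idealNetwork_environment]; cases p <;> rfl
      functionality := idealNetwork_functionality hfC
      honest := idealNetwork_honest hP hPC hfp
      congr := fun i hi => idealNetwork_congr hi _ _ }
  have e₃ : (idealNetwork π f alice bob hf (corrupted alice π (some (!p))) S p (!p) true).exec
      k [] [true] ≤ (idealNetwork π f alice bob hf (corrupted alice π (some (!p))) S
        false false true).exec k [] [true] := by
    rw [Network.exec_eq, Network.exec_eq]
    exact ENNReal.toReal_mono (ne_top_of_le_ne_top ENNReal.one_ne_top
      (iSup_le fun n => Network.accept_le_one)) hN.iSup_accept_le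
  rw [← e₁, ← e₂]
  have h₁' := (abs_le.1 h₁).2
  have h₂' := (abs_le.1 h₂).1
  unfold idealNetwork at e₃
  unfold realNetwork
  simp only [Option.isSome_some]
  linarith

end HybridProtocol

end ClassicalUC

theorem mainTheorem7 (alice bob f : ClassicalUC.Identity)
    (hab : alice ≠ bob) (ha : alice ≠ []) (hb : bob ≠ [])
    (hf : f ≠ ClassicalUC.environment ∧ f ≠ ClassicalUC.adversary) :
    ¬ ∃ π : ClassicalUC.Protocol,
      alice ∈ π.parties ∧ bob ∈ π.parties ∧ f ∉ π.parties ∧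
      π.InCommitmentHybridModel ∧ π.IsPPT ∧
      π.EmulatesFunctionality f (ClassicalUC.andFunctionality f alice bob) hf := by
  rintro ⟨π, halice, hbob, hfp, hcom, -, h⟩
  obtain ⟨d⟩ := hcom.nonempty_hybridProtocol
  -- any `ε < 1 / 16` contradicts the inequalities below
  have hε : (0 : ℝ) < 1 / 20 := by norm_num
  have hcorrect := d.eventually_mass_univ halice hbob hfp hab ha hb h hε
  have hprivate := d.eventually_mass_le halice hbob hfp hab ha hb h hε
  obtain ⟨k, h₀₀, h₀₁, h₁₀, h₁₁, hA, hB⟩ := ((hcorrect false false).and <|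
    (hcorrect false true).and <| (hcorrect true false).and <| (hcorrect true true).and <|
    (hprivate true fun k => d.splitSet alice bob k).and
      (hprivate false fun k t => !d.splitSet alice bob k t)).exists
  simp only [Bool.and_false, Bool.false_and, Bool.and_self, Bool.false_eq_true, if_false, if_true,
    Bool.not_true, Bool.not_false] at h₀₀ h₀₁ h₁₀ h₁₁ hA hB
  rw [abs_le] at h₀₀ h₀₁ h₁₀ h₁₁
  have hmin := d.mass_splitSet_le alice bob k
  have e₀₀ := d.mass_add_mass_not alice bob k false false (d.splitSet alice bob k)
  have e₀₁ := d.mass_add_mass_not alice bob k false true (d.splitSet alice bob k)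
  have e₁₀ := d.mass_add_mass_not alice bob k true false (d.splitSet alice bob k)
  linarith [h₀₀.2, h₀₁.1, h₁₀.1, h₁₁.2]
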